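/- Notation. For $i\in\{1,2\}$ let $\alpha_i\in\mathbb R$, $N_i\ge 1$ and $\mathrm L_i=(\mathrm D-\alpha_i\mathrm I)^{N_i}$, acting on $\mathcal D'(\mathbb R)$, with null space $\mathcal N_{\mathrm L_i}=\{f\in\mathcal D'(\mathbb R):\mathrm L_i f=0\}$ and causal Green's function $g_{\mathrm L_i}(t)=t_+^{N_i-1}e^{\alpha_i t}/(N_i-1)!$. Let $(p_{i,n})_{n=1}^{N_i}$ be a basis of $\mathcal N_{\mathrm L_i}$ and let $\phi_{i,1},\dots,\phi_{i,N_i}\in\mathcal D(\mathbb R)$ satisfy $\langle p_{i,n},\phi_{i,m}\rangle=\delta_{n,m}$ (a universal $\mathrm L_i$-admissible system). Put $$\mathrm{proj}_{\mathcal N_{\mathrm L_i}}f=\sum_{n=1}^{N_i}\langle f,\phi_{i,n}\rangle p_{i,n},\qquad g_{\phi_i}(t,x)=g_{\mathrm L_i}(t-x)-\sum_{n=1}^{N_i}\langle g_{\mathrm L_i},\phi_{i,n}(\cdot+x)\rangle\,p_{i,n}(t).$$ Let $\mathcal M(\mathbb R^k)$ be the space of bounded (finite signed) Borel measures with the total variation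 norm $\|\cdot\|_{\mathcal M}$, regarded as distributions, and put $$\mathrm L_{\phi_i}^{-1}\{m\}(t)=\int_{\mathbb R} g_{\phi_i}(t,x)\,dm(x),\qquad [\mathrm L_{\phi_1}^{-1}\otimes\mathrm L_{\phi_2}^{-1}]\{m\}(t_1,t_2)=\int_{\mathbb R^2} g_{\phi_1}(t_1,x_1)g_{\phi_2}(t_2,x_2)\,dm(x_1,x_2)$$ for $m\in\mathcal M(\mathbb R)$, respectively $m\in\mathcal M(\mathbb R^2)$. The tensor product of two spaces of distributions on $\mathbb R$ is the span in $\mathcal D'(\mathbb R^2)$ of the tensor products of their elements. The native space $\mathcal M_{\mathrm L_1\otimes\mathrm L_2}(\mathbb R^2)\subset\mathcal D'(\mathbb R^2)$ is the sum of the four spaces $$[\mathrm L_{\phi_1}^{-1}\otimes\mathrm L_{\phi_2}^{-1}]\{\mathcal M(\mathbb R^2)\},\quad \mathcal N_{\mathrm L_1}\otimes\mathrm L_{\phi_2}^{-1}\{\mathcal M(\mathbb R)\},\quad \mathrm L_{\phi_1}^{-1}\{\mathcal M(\mathbb R)\}\otimes\mathcal N_{\mathrm L_2},\quad \mathcal N_{\mathrm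 L_1}\otimes\mathcal N_{\mathrm L_2}.$$ On $\mathcal N_{\mathrm L_1}\otimes\mathcal M(\mathbb R)$, $\mathcal M(\mathbb R)\otimes\mathcal N_{\mathrm L_2}$ and $\mathcal N_{\mathrm L_1}\otimes\mathcal N_{\mathrm L_2}$ use the norms $\|\sum_n p_{1,n}\otimes m_n\|_{p_1,\mathcal M}=\sum_n\|m_n\|_{\mathcal M}$, $\|\sum_n m_n\otimes p_{2,n}\|_{\mathcal M,p_2}=\sum_n\|m_n\|_{\mathcal M}$ and $\|\sum_{n,n'}d_{n,n'}p_{1,n}\otimes p_{2,n'}\|_{p_1,p_2}=\sum_{n,n'}|d_{n,n'}|$. Theorem. The integrals above are well defined, and $\mathrm L_{\phi_i}^{-1}\{m\}$ and $[\mathrm L_{\phi_1}^{-1}\otimes\mathrm L_{\phi_2}^{-1}]\{m\}$ are locally integrable functions. 1. The four spaces are in direct sum, and every $f\in\mathcal M_{\mathrm L_1\otimes\mathrm L_2}(\mathbb R^2)$ has a unique representation $$f=[\mathrm L_{\phi_1}^{-1}\otimes\mathrm L_{\phi_2}^{-1}]\{m\}+\sum_{n=1}^{N_1}p_{1,n}\otimes\mathrm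 L_{\phi_2}^{-1}\{m_{1,n}\}+\sum_{n=1}^{N_2}\mathrm L_{\phi_1}^{-1}\{m_{2,n}\}\otimes p_{2,n}+\sum_{n=1}^{N_1}\sum_{n'=1}^{N_2}d_{n,n'}\,p_{1,n}\otimes p_{2,n'}$$ with $m\in\mathcal M(\mathbb R^2)$, $(m_{1,n})\in\mathcal M(\mathbb R)^{N_1}$, $(m_{2,n})\in\mathcal M(\mathbb R)^{N_2}$ and $\mathbf d=(d_{n,n'})\in\mathbb R^{N_1\times N_2}$; the four terms lie in the four respective spaces, and every such sum belongs to the native space. 2. The maps $\mathrm L_1\otimes\mathrm L_2$, $\mathrm{proj}_{\mathcal N_{\mathrm L_1}}\otimes\mathrm L_2$, $\mathrm L_1\otimes\mathrm{proj}_{\mathcal N_{\mathrm L_2}}$ and $\mathrm{proj}_{\mathcal N_{\mathrm L_1}}\otimes\mathrm{proj}_{\mathcal N_{\mathrm L_2}}$, given on tensor products by $S\otimes T\mapsto A S\otimes B T$, extend continuously (to continuous linear maps of $\mathcal D'(\mathbb R^2)$, and hence) to the whole native space. On $f$ as in 1 their values are $m$, $\sum_n p_{1,n}\otimes m_{1,n}$,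 $\sum_n m_{2,n}\otimes p_{2,n}$ and $\sum_{n,n'}d_{n,n'}p_{1,n}\otimes p_{2,n'}$, respectively, and they are continuous from the native space, with the norm in 3, to $\mathcal M(\mathbb R^2)$, $\mathcal N_{\mathrm L_1}\otimes\mathcal M(\mathbb R)$, $\mathcal M(\mathbb R)\otimes\mathcal N_{\mathrm L_2}$ and $\mathcal N_{\mathrm L_1}\otimes\mathcal N_{\mathrm L_2}$. 3. The native space is a Banach space for the norm $$\begin{aligned}\|f\|&=\|[\mathrm L_1\otimes\mathrm L_2]f\|_{\mathcal M}+\|[\mathrm{proj}_{\mathcal N_{\mathrm L_1}}\otimes\mathrm L_2]f\|_{p_1,\mathcal M}+\|[\mathrm L_1\otimes\mathrm{proj}_{\mathcal N_{\mathrm L_2}}]f\|_{\mathcal M,p_2}+\|[\mathrm{proj}_{\mathcal N_{\mathrm L_1}}\otimes\mathrm{proj}_{\mathcal N_{\mathrm L_2}}]f\|_{p_1,p_2}\\&=\|m\|_{\mathcal M}+\sum_{n=1}^{N_1}\|m_{1,n}\|_{\mathcal M}+\sum_{n=1}^{N_2}\|m_{2,n}\|_{\mathcal M}+\sum_{n,n'}|d_{n,n'}|,\end{aligned}$$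 and this norm is additive over the four components of $f$. -/

import Mathlib

open MeasureTheory TopologicalSpace Set
open scoped Distributions LineDeriv ENNReal

noncomputable section

namespace TensorSpline

/-! ### Test functions, distributions, tensor products -/

/-- Test functions on the line: real-valued, smooth, compactly supported. -/
abbrev Test1 : Type := TestFunction (⊤ : Opens ℝ) ℝ ⊤

/-- Test functions on the plane. -/
abbrev Test2 : Type := TestFunction (⊤ : Opens (ℝ × ℝ)) ℝ ⊤

/-- Distributions on the line. -/
abbrev Dist1 : Type := Distribution (⊤ : Opens ℝ) ℝ ⊤

/-- Distributions on the plane. -/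
abbrev Dist2 : Type := Distribution (⊤ : Opens (ℝ × ℝ)) ℝ ⊤

theorem iteratedFDeriv_tensor_le {f g : ℝ → ℝ} (hf : ContDiff ℝ (⊤ : ℕ∞) f) (hg : ContDiff ℝ (⊤ : ℕ∞) g)
    (k : ℕ) (z : ℝ × ℝ) :
    ‖iteratedFDeriv ℝ k (fun w : ℝ × ℝ => f w.1 * g w.2) z‖ ≤
      ∑ i ∈ Finset.range (k + 1), (k.choose i : ℝ) * ‖iteratedFDeriv ℝ i f z.1‖ *
        ‖iteratedFDeriv ℝ (k - i) g z.2‖ := by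
  have hk : (k : WithTop ℕ∞) ≤ (⊤ : ℕ∞) := by exact_mod_cast le_top
  have hF : ContDiff ℝ (⊤ : ℕ∞) (f ∘ (ContinuousLinearMap.fst ℝ ℝ ℝ)) := hf.comp (by fun_prop)
  have hG : ContDiff ℝ (⊤ : ℕ∞) (g ∘ (ContinuousLinearMap.snd ℝ ℝ ℝ)) := hg.comp (by fun_prop)
  have key := norm_iteratedFDeriv_mul_le (𝕜 := ℝ) hF hG z hk
  refine le_trans key (Finset.sum_le_sum fun i _ => ?_)
  have h1 : ‖iteratedFDeriv ℝ i (f ∘ (ContinuousLinearMap.fst ℝ ℝ ℝ)) z‖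
      ≤ ‖iteratedFDeriv ℝ i f z.1‖ := by
    rw [ContinuousLinearMap.iteratedFDeriv_comp_right (i := i) _ hf z
      (WithTop.coe_le_coe.2 le_top)]
    refine le_trans (ContinuousMultilinearMap.norm_compContinuousLinearMap_le _ _) ?_
    have : ∏ _j : Fin i, ‖ContinuousLinearMap.fst ℝ ℝ ℝ‖ ≤ 1 :=
      Finset.prod_le_one (fun _ _ => norm_nonneg _)
        (fun _ _ => ContinuousLinearMap.norm_fst_le ℝ ℝ ℝ)
    exact mul_le_of_le_one_right (norm_nonneg _) this
  have h2 : ‖iteratedFDeriv ℝ (k - i) (g ∘ (ContinuousLinearMap.snd ℝ ℝ ℝ)) z‖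
      ≤ ‖iteratedFDeriv ℝ (k - i) g z.2‖ := by
    rw [ContinuousLinearMap.iteratedFDeriv_comp_right (i := k - i) _ hg z
      (WithTop.coe_le_coe.2 le_top)]
    refine le_trans (ContinuousMultilinearMap.norm_compContinuousLinearMap_le _ _) ?_
    have : ∏ _j : Fin (k - i), ‖ContinuousLinearMap.snd ℝ ℝ ℝ‖ ≤ 1 :=
      Finset.prod_le_one (fun _ _ => norm_nonneg _)
        (fun _ _ => ContinuousLinearMap.norm_snd_le ℝ ℝ ℝ)
    exact mul_le_of_le_one_right (norm_nonneg _) this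
  gcongr

/-- Bound for all derivatives of a test function. -/
theorem exists_bound (φ : Test1) (k : ℕ) :
    ∃ C : ℝ, 0 ≤ C ∧ ∀ i ≤ k, ∀ x, ‖iteratedFDeriv ℝ i φ x‖ ≤ C := by
  have h : ∀ i : ℕ, ∃ C : ℝ, 0 ≤ C ∧ ∀ x, ‖iteratedFDeriv ℝ i φ x‖ ≤ C := by
    intro i
    obtain ⟨C, hC⟩ := (φ.contDiff.continuous_iteratedFDeriv
      (by exact_mod_cast le_top)).bounded_above_of_compact_support
      (φ.hasCompactSupport.iteratedFDeriv (𝕜 := ℝ) i)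
    exact ⟨C, (norm_nonneg _).trans (hC 0), hC⟩
  choose C hC0 hC using h
  refine ⟨∑ i ∈ Finset.range (k + 1), C i, Finset.sum_nonneg fun i _ => hC0 i, fun i hi x => ?_⟩
  exact (hC i x).trans (Finset.single_le_sum (f := C) (fun j _ => hC0 j) (Finset.mem_range.2 (by omega)))

/-- Continuity criterion for linear maps between spaces of smooth functions supported in a
fixed compact set. -/
theorem continuous_of_bound {E₁ E₂ : Type} [NormedAddCommGroup E₁] [NormedSpace ℝ E₁]
    [NormedAddCommGroup E₂] [NormedSpace ℝ E₂] {K₁ : Compacts E₁} {K₂ : Compacts E₂}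
    (A : ContDiffMapSupportedIn E₁ ℝ ⊤ K₁ →ₗ[ℝ] ContDiffMapSupportedIn E₂ ℝ ⊤ K₂)
    (h : ∀ i : ℕ, ∃ (s : Finset ℕ) (C : ℝ), 0 ≤ C ∧ ∀ f, ∀ x ∈ K₂,
      ‖iteratedFDeriv ℝ i (A f) x‖ ≤
        C * (s.sup fun j => ContDiffMapSupportedIn.seminorm ℝ E₁ ℝ ⊤ K₁ j) f) :
    Continuous A := by
  refine WithSeminorms.continuous_of_isBounded (ContDiffMapSupportedIn.withSeminorms ℝ E₁ ℝ ⊤ K₁)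
    (ContDiffMapSupportedIn.withSeminorms ℝ E₂ ℝ ⊤ K₂) _ (.of_real fun i => ?_)
  obtain ⟨s, C, hC, h⟩ := h i
  exact ⟨s, C, fun f => ((A f).seminorm_top_le_iff ℝ (mul_nonneg hC (apply_nonneg _ _)) i).2
    fun x hx => h f x hx⟩

/-- The pure tensor `(x₁, x₂) ↦ φ x₁ * ψ x₂` of two test functions. -/
def tensorTest (φ ψ : Test1) : Test2 where
  toFun z := φ z.1 * ψ z.2
  contDiff' := (φ.contDiff.comp contDiff_fst).mul (ψ.contDiff.comp contDiff_snd)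
  hasCompactSupport' := by
    refine HasCompactSupport.intro (φ.hasCompactSupport.prod ψ.hasCompactSupport) fun z hz => ?_
    by_contra h
    refine hz ⟨subset_tsupport _ fun h0 => h ?_, subset_tsupport _ fun h0 => h ?_⟩ <;> simp [h0]
  tsupport_subset' := fun _ _ => trivial

theorem tensorTest_apply (φ ψ : Test1) (z : ℝ × ℝ) : tensorTest φ ψ z = φ z.1 * ψ z.2 := rfl

/-- `ψ ↦ φ ⊗ ψ` as a continuous linear map. -/
def tensorTestLeft (φ : Test1) : Test1 →L[ℝ] Test2 :=
  TestFunction.mkCLM ℝ (tensorTest φ)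
    (fun f g => by ext z; simp [tensorTest_apply, mul_add])
    (fun c f => by ext z; simp [tensorTest_apply]; ring)
    (fun K _ => by
      let K' : Compacts (ℝ × ℝ) := ⟨tsupport φ ×ˢ (K : Set ℝ), φ.hasCompactSupport.prod K.isCompact⟩
      let A : ContDiffMapSupportedIn ℝ ℝ ⊤ K →ₗ[ℝ] ContDiffMapSupportedIn (ℝ × ℝ) ℝ ⊤ K' :=
        { toFun := fun ψ => ⟨fun z => φ z.1 * ψ z.2,
            (φ.contDiff.comp contDiff_fst).mul (ψ.contDiff.comp contDiff_snd), fun z hz => by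
              by_contra h
              refine hz ⟨subset_tsupport _ fun h0 => h ?_, ?_⟩
              · simp [h0]
              · by_contra h2
                exact h (by simp [ψ.zero_on_compl h2])⟩
          map_add' := fun f g => by ext z; exact mul_add _ _ _
          map_smul' := fun c f => by ext z; exact mul_left_comm _ _ _ }
      have hA : Continuous A := continuous_of_bound A (fun k => by
            obtain ⟨C, hC0, hC⟩ := exists_bound φ k
            refine ⟨Finset.Iic k, 2 ^ k * C, by positivity, fun ψ z _ => ?_⟩
            refine (iteratedFDeriv_tensor_le φ.contDiff ψ.contDiff k z).trans ?_
            calc _ ≤ ∑ i ∈ Finset.range (k + 1), (k.choose i : ℝ) * C *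
                  ((Finset.Iic k).sup fun j => ContDiffMapSupportedIn.seminorm ℝ ℝ ℝ ⊤ K j) ψ := by
                  gcongr with i hi
                  · exact hC i (Finset.mem_range_succ_iff.1 hi) _
                  · exact (ContDiffMapSupportedIn.norm_iteratedFDeriv_apply_le_seminorm_top
                      ℝ).trans (Seminorm.le_finset_sup_apply (Finset.mem_Iic.2 (Nat.sub_le k i)))
              _ = _ := by
                  rw [← Finset.sum_mul, ← Finset.sum_mul, ← Nat.cast_sum, Nat.sum_range_choose]
                  push_cast; ring)
      exact (TestFunction.continuous_ofSupportedIn (Ω := (⊤ : Opens (ℝ × ℝ))) (K := K')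
        (fun _ _ => trivial)).comp hA)

/-- `ψ ↦ ψ ⊗ φ` as a continuous linear map. -/
def tensorTestRight (φ : Test1) : Test1 →L[ℝ] Test2 :=
  TestFunction.mkCLM ℝ (fun ψ => tensorTest ψ φ)
    (fun f g => by ext z; simp [tensorTest_apply, add_mul])
    (fun c f => by ext z; simp [tensorTest_apply]; ring)
    (fun K _ => by
      let K' : Compacts (ℝ × ℝ) := ⟨(K : Set ℝ) ×ˢ tsupport φ, K.isCompact.prod φ.hasCompactSupport⟩
      let A : ContDiffMapSupportedIn ℝ ℝ ⊤ K →ₗ[ℝ] ContDiffMapSupportedIn (ℝ × ℝ) ℝ ⊤ K' :=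
        { toFun := fun ψ => ⟨fun z => ψ z.1 * φ z.2,
            (ψ.contDiff.comp contDiff_fst).mul (φ.contDiff.comp contDiff_snd), fun z hz => by
              by_contra h
              refine hz ⟨?_, subset_tsupport _ fun h0 => h ?_⟩
              · by_contra h2
                exact h (by simp [ψ.zero_on_compl h2])
              · simp [h0]⟩
          map_add' := fun f g => by ext z; exact add_mul _ _ _
          map_smul' := fun c f => by ext z; exact mul_assoc _ _ _ }
      have hA : Continuous A := continuous_of_bound A (fun k => by
            obtain ⟨C, hC0, hC⟩ := exists_bound φ k
            refine ⟨Finset.Iic k, 2 ^ k * C, by positivity, fun ψ z _ => ?_⟩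
            refine (iteratedFDeriv_tensor_le ψ.contDiff φ.contDiff k z).trans ?_
            calc _ ≤ ∑ i ∈ Finset.range (k + 1), (k.choose i : ℝ) *
                  ((Finset.Iic k).sup fun j => ContDiffMapSupportedIn.seminorm ℝ ℝ ℝ ⊤ K j) ψ *
                    C := by
                  gcongr with i hi
                  · exact (ContDiffMapSupportedIn.norm_iteratedFDeriv_apply_le_seminorm_top
                      ℝ).trans (Seminorm.le_finset_sup_apply
                        (Finset.mem_Iic.2 (Finset.mem_range_succ_iff.1 hi)))
                  · exact hC (k - i) (Nat.sub_le k i) _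
              _ = _ := by
                  rw [← Finset.sum_mul, ← Finset.sum_mul, ← Nat.cast_sum, Nat.sum_range_choose]
                  push_cast; ring)
      exact (TestFunction.continuous_ofSupportedIn (Ω := (⊤ : Opens (ℝ × ℝ))) (K := K')
        (fun _ _ => trivial)).comp hA)

theorem tensorTestLeft_apply (φ ψ : Test1) : tensorTestLeft φ ψ = tensorTest φ ψ := rfl

theorem tensorTestRight_apply (φ ψ : Test1) : tensorTestRight φ ψ = tensorTest ψ φ := rfl

/-- The slice `x ↦ ψ (x, y)` of a test function on the plane. -/
def slice (ψ : Test2) (y : ℝ) : Test1 where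
  toFun x := ψ (x, y)
  contDiff' := ψ.contDiff.comp (contDiff_id.prodMk contDiff_const)
  hasCompactSupport' := by
    refine HasCompactSupport.intro (ψ.hasCompactSupport.image continuous_fst) fun x hx => ?_
    by_contra h
    exact hx ⟨(x, y), subset_tsupport _ h, rfl⟩
  tsupport_subset' := fun _ _ => trivial

theorem slice_apply (ψ : Test2) (y x : ℝ) : slice ψ y x = ψ (x, y) := rfl

/-- Derivative of a test function on the line. -/
def der : Test1 →L[ℝ] Test1 := TestFunction.lineDerivCLM ℝ (1 : ℝ)

/-- Partial derivative of a test function on the plane, first variable. -/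
def der₁ : Test2 →L[ℝ] Test2 := TestFunction.lineDerivCLM ℝ ((1, 0) : ℝ × ℝ)

/-- Partial derivative of a test function on the plane, second variable. -/
def der₂ : Test2 →L[ℝ] Test2 := TestFunction.lineDerivCLM ℝ ((0, 1) : ℝ × ℝ)

theorem test_hasFDerivAt (ψ : Test2) (z : ℝ × ℝ) : HasFDerivAt ψ (fderiv ℝ ψ z) z :=
  ((ψ.contDiff.differentiable (by simp)) z).hasFDerivAt

theorem der_apply (φ : Test1) (x : ℝ) : der φ x = deriv φ x := by
  have h : der φ x = fderiv ℝ φ x 1 := by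
    simp only [der, TestFunction.lineDerivCLM_eq_fderivCLM, TestFunction.fderivCLM_apply]
    simp
  rw [h, fderiv_apply_one_eq_deriv]

theorem der₁_apply (ψ : Test2) (z : ℝ × ℝ) : der₁ ψ z = fderiv ℝ ψ z (1, 0) := by
  simp only [der₁, TestFunction.lineDerivCLM_eq_fderivCLM, TestFunction.fderivCLM_apply]
  simp

theorem der₂_apply (ψ : Test2) (z : ℝ × ℝ) : der₂ ψ z = fderiv ℝ ψ z (0, 1) := by
  simp only [der₂, TestFunction.lineDerivCLM_eq_fderivCLM, TestFunction.fderivCLM_apply]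
  simp

theorem hasDerivAt_der₁ (ψ : Test2) (x y : ℝ) :
    HasDerivAt (fun t => ψ (t, y)) (der₁ ψ (x, y)) x := by
  rw [der₁_apply]
  exact (test_hasFDerivAt ψ (x, y)).comp_hasDerivAt x
    ((hasDerivAt_id x).prodMk (hasDerivAt_const x y))

theorem hasDerivAt_der₂ (ψ : Test2) (x y : ℝ) :
    HasDerivAt (fun t => ψ (x, t)) (der₂ ψ (x, y)) y := by
  rw [der₂_apply]
  exact (test_hasFDerivAt ψ (x, y)).comp_hasDerivAt y
    ((hasDerivAt_const y x).prodMk (hasDerivAt_id y))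

theorem der_slice (ψ : Test2) (y : ℝ) : der (slice ψ y) = slice (der₁ ψ) y := by
  ext x
  rw [der_apply, slice_apply]
  exact (hasDerivAt_der₁ ψ x y).deriv

theorem der₁_der₂ (ψ : Test2) : der₁ (der₂ ψ) = der₂ (der₁ ψ) := by
  ext z
  have hsm : ContDiff ℝ (⊤ : ℕ∞) (fderiv ℝ ψ) :=
    ψ.contDiff.fderiv_right (by simp)
  have hd : Differentiable ℝ (fderiv ℝ ψ) := hsm.differentiable (by simp)
  have e₂ : ⇑(der₂ ψ) = fun w => fderiv ℝ ψ w (0, 1) := funext (der₂_apply ψ)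
  have e₁ : ⇑(der₁ ψ) = fun w => fderiv ℝ ψ w (1, 0) := funext (der₁_apply ψ)
  rw [der₁_apply, der₂_apply, e₁, e₂, fderiv_clm_apply (hd z) (by fun_prop),
    fderiv_clm_apply (hd z) (by fun_prop)]
  have hs : IsSymmSndFDerivAt ℝ ψ z :=
    (ψ.contDiff.contDiffAt).isSymmSndFDerivAt (by
      simp only [minSmoothness_of_isRCLikeNormedField]; exact WithTop.coe_le_coe.2 le_top)
  simpa using hs.eq (1, 0) (0, 1)

theorem der_pow_slice (j : ℕ) (ψ : Test2) (y : ℝ) :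
    (der ^ j) (slice ψ y) = slice ((der₁ ^ j) ψ) y := by
  induction j generalizing ψ with
  | zero => rfl
  | succ j ih =>
    rw [pow_succ, pow_succ, mul_apply_eq_comp, mul_apply_eq_comp,
      der_slice, ih]

theorem der₁_pow_der₂ (j : ℕ) (ψ : Test2) : (der₁ ^ j) (der₂ ψ) = der₂ ((der₁ ^ j) ψ) := by
  induction j generalizing ψ with
  | zero => rfl
  | succ j ih =>
    rw [pow_succ, mul_apply_eq_comp, mul_apply_eq_comp, der₁_der₂, ih]

theorem iteratedDeriv_eq_der_pow (φ : Test1) (j : ℕ) : iteratedDeriv j φ = (der ^ j) φ := by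
  induction j with
  | zero => simp
  | succ j ih =>
    ext x
    rw [iteratedDeriv_succ, ih, pow_succ', mul_apply_eq_comp, der_apply]

/-- A distribution has finite order on each compact set. -/
theorem dist_bound (S : Dist1) (K : Compacts ℝ) :
    ∃ (n : ℕ) (C : ℝ), 0 ≤ C ∧ ∀ φ : Test1, (∀ x ∉ K, φ x = 0) → ∀ M : ℝ, 0 ≤ M →
      (∀ j ≤ n, ∀ x, |(der ^ j) φ x| ≤ M) → |S φ| ≤ C * M := by
  let A : ContDiffMapSupportedIn ℝ ℝ ⊤ K →ₗ[ℝ] ℝ :=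
    (S : Test1 →ₗ[ℝ] ℝ) ∘ₗ
      (TestFunction.ofSupportedInCLM ℝ (Ω := (⊤ : Opens ℝ)) (K := K) fun _ _ => trivial :
        ContDiffMapSupportedIn ℝ ℝ ⊤ K →L[ℝ] Test1).toLinearMap
  have hA : Continuous A := (map_continuous S).comp
    (TestFunction.continuous_ofSupportedIn (Ω := (⊤ : Opens ℝ)) (K := K) fun _ _ => trivial)
  obtain ⟨s, C, -, hC⟩ := Seminorm.bound_of_continuous
    (ContDiffMapSupportedIn.withSeminorms ℝ ℝ ℝ ⊤ K) ((normSeminorm ℝ ℝ).comp A)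
    (by exact hA.norm)
  refine ⟨s.sup id, C, C.2, fun φ hφ M hM hb => ?_⟩
  let φK : ContDiffMapSupportedIn ℝ ℝ ⊤ K := ⟨φ, φ.contDiff, fun x hx => hφ x hx⟩
  have h1 := hC φK
  have h2 : (s.sup (ContDiffMapSupportedIn.seminorm ℝ ℝ ℝ ⊤ K)) φK ≤ M := by
    refine Seminorm.finset_sup_apply_le hM fun j hj => ?_
    rw [ContDiffMapSupportedIn.seminorm_top_le_iff ℝ hM]
    intro x _
    rw [norm_iteratedFDeriv_eq_norm_iteratedDeriv]
    have := hb j (Finset.le_sup (f := id) hj) x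
    rwa [← iteratedDeriv_eq_der_pow] at this
  have h3 : |S φ| ≤ C * (s.sup (ContDiffMapSupportedIn.seminorm ℝ ℝ ℝ ⊤ K)) φK := h1
  exact h3.trans (mul_le_mul_of_nonneg_left h2 C.2)

theorem exists_bound₂ (ψ : Test2) : ∃ C : ℝ, 0 ≤ C ∧ ∀ z, |ψ z| ≤ C := by
  obtain ⟨C, hC⟩ := ψ.continuous.bounded_above_of_compact_support ψ.hasCompactSupport
  exact ⟨C, (norm_nonneg _).trans (hC 0), hC⟩

theorem taylor_bound (ψ : Test2) {B : ℝ} (hB : ∀ z, |der₂ (der₂ ψ) z| ≤ B) (x a b : ℝ) :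
    |ψ (x, b) - ψ (x, a) - (b - a) * der₂ ψ (x, a)| ≤ B * |b - a| ^ 2 := by
  have hB0 : 0 ≤ B := (abs_nonneg _).trans (hB 0)
  have h1 : ∀ t ∈ uIcc a b, |der₂ ψ (x, t) - der₂ ψ (x, a)| ≤ B * |b - a| := by
    intro t ht
    have := Convex.norm_image_sub_le_of_norm_hasDerivWithin_le (f := fun t => der₂ ψ (x, t))
      (f' := fun t => der₂ (der₂ ψ) (x, t)) (C := B) (s := univ) (x := a) (y := t)
      (fun t _ => (hasDerivAt_der₂ (der₂ ψ) x t).hasDerivWithinAt) (fun t _ => hB _)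
      convex_univ trivial trivial
    refine this.trans (mul_le_mul_of_nonneg_left ?_ hB0)
    exact abs_sub_left_of_mem_uIcc ht
  have h2 := Convex.norm_image_sub_le_of_norm_hasDerivWithin_le
    (f := fun t => ψ (x, t) - (t - a) * der₂ ψ (x, a))
    (f' := fun t => der₂ ψ (x, t) - der₂ ψ (x, a)) (C := B * |b - a|) (s := uIcc a b)
    (x := a) (y := b)
    (fun t _ => by
      have := (hasDerivAt_der₂ ψ x t).sub
        (((hasDerivAt_id t).sub_const a).mul_const (der₂ ψ (x, a)))
      rw [one_mul] at this
      exact this.hasDerivWithinAt)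
    h1 (convex_uIcc a b) left_mem_uIcc right_mem_uIcc
  have e : ψ (x, b) - (b - a) * der₂ ψ (x, a) - (ψ (x, a) - (a - a) * der₂ ψ (x, a)) =
      ψ (x, b) - ψ (x, a) - (b - a) * der₂ ψ (x, a) := by ring
  rw [Real.norm_eq_abs, Real.norm_eq_abs, e] at h2
  rw [pow_two, ← mul_assoc]
  exact h2

theorem hasDerivAt_apply_slice (S : Dist1) (ψ : Test2) (y : ℝ) :
    HasDerivAt (fun t => S (slice ψ t)) (S (slice (der₂ ψ) y)) y := by
  let K : Compacts ℝ := ⟨Prod.fst '' tsupport ψ, ψ.hasCompactSupport.image continuous_fst⟩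
  have hK : ∀ x ∉ K, ∀ t, ψ (x, t) = 0 := fun x hx t => by
    by_contra h
    exact hx ⟨(x, t), subset_tsupport _ h, rfl⟩
  have hK' : ∀ x ∉ K, ∀ t, der₂ ψ (x, t) = 0 := fun x hx t => by
    rw [← (hasDerivAt_der₂ ψ x t).deriv]
    simp [hK x hx]
  obtain ⟨n, C, hC0, hC⟩ := dist_bound S K
  choose B hB0 hB using fun j : ℕ => exists_bound₂ (der₂ (der₂ ((der₁ ^ j) ψ)))
  let M : ℝ := ∑ j ∈ Finset.range (n + 1), B j
  have hM0 : 0 ≤ M := Finset.sum_nonneg fun j _ => hB0 j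
  have key : ∀ t, |S (slice ψ t) - S (slice ψ y) - (t - y) * S (slice (der₂ ψ) y)| ≤
      C * M * |t - y| ^ 2 := by
    intro t
    have e : S (slice ψ t) - S (slice ψ y) - (t - y) * S (slice (der₂ ψ) y) =
        S (slice ψ t - slice ψ y - (t - y) • slice (der₂ ψ) y) := by
      rw [map_sub, map_sub, map_smul, smul_eq_mul]
    rw [e, mul_assoc]
    refine hC _ (fun x hx => ?_) _ (by positivity) fun j hj x => ?_
    · simp [slice_apply, hK x hx, hK' x hx]
    · rw [map_sub, map_sub, map_smul, der_pow_slice, der_pow_slice, der_pow_slice, der₁_pow_der₂]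
      have := taylor_bound ((der₁ ^ j) ψ) (hB j) x y t
      refine (le_of_eq_of_le ?_ this).trans (mul_le_mul_of_nonneg_right ?_ (by positivity))
      · simp [slice_apply]
      · exact Finset.single_le_sum (f := B) (fun j _ => hB0 j) (Finset.mem_range.2 (by omega))
  rw [hasDerivAt_iff_isLittleO]
  have h1 : (fun t => S (slice ψ t) - S (slice ψ y) - (t - y) • S (slice (der₂ ψ) y))
      =O[nhds y] fun t => (t - y) ^ 2 :=
    Asymptotics.IsBigO.of_bound (C * M) (Filter.Eventually.of_forall fun t => by
      simpa using key t)
  refine h1.trans_isLittleO ?_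
  have h2 : (fun h : ℝ => h ^ 2) =o[nhds 0] fun h : ℝ => h := by
    simpa using Asymptotics.isLittleO_pow_id (𝕜 := ℝ) (n := 2) (by norm_num)
  have h3 : Filter.Tendsto (fun t => t - y) (nhds y) (nhds 0) := by
    have h := (by fun_prop : Continuous fun t : ℝ => t - y).tendsto y
    rwa [sub_self] at h
  exact h2.comp_tendsto h3

theorem iteratedDeriv_apply_slice (S : Dist1) (ψ : Test2) (k : ℕ) :
    iteratedDeriv k (fun t => S (slice ψ t)) = fun t => S (slice ((der₂ ^ k) ψ) t) := by
  induction k with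
  | zero => simp
  | succ k ih =>
    ext t
    rw [iteratedDeriv_succ, ih, pow_succ', mul_apply_eq_comp]
    exact (hasDerivAt_apply_slice S _ t).deriv

theorem contDiff_apply_slice (S : Dist1) (ψ : Test2) :
    ContDiff ℝ (⊤ : ℕ∞) (fun t => S (slice ψ t)) :=
  contDiff_of_differentiable_iteratedDeriv fun k _ => by
    rw [iteratedDeriv_apply_slice]
    exact fun t => (hasDerivAt_apply_slice S _ t).differentiableAt

theorem apply_slice_eq_zero (S : Dist1) (ψ : Test2) {y : ℝ} (hy : ∀ x, ψ (x, y) = 0) :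
    S (slice ψ y) = 0 := by
  have : slice ψ y = 0 := by ext x; simp [slice_apply, hy x]
  rw [this, map_zero]

/-- Partial pairing of a distribution `S` on the line with the first variable of a test function
on the plane: the test function `y ↦ S (ψ (·, y))`. -/
def pairFst (S : Dist1) (ψ : Test2) : Test1 where
  toFun y := S (slice ψ y)
  contDiff' := contDiff_apply_slice S ψ
  hasCompactSupport' := by
    refine HasCompactSupport.intro (ψ.hasCompactSupport.image continuous_snd) fun y hy => ?_
    refine apply_slice_eq_zero S ψ fun x => ?_
    by_contra h
    exact hy ⟨(x, y), subset_tsupport _ h, rfl⟩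
  tsupport_subset' := fun _ _ => trivial

theorem pairFst_apply (S : Dist1) (ψ : Test2) (y : ℝ) : pairFst S ψ y = S (slice ψ y) := rfl

theorem der₂_pow_eq_zero (ψ : Test2) {K : Set (ℝ × ℝ)} (hK : IsClosed K) (hψ : ∀ z ∉ K, ψ z = 0)
    (k : ℕ) : ∀ z ∉ K, (der₂ ^ k) ψ z = 0 := by
  induction k with
  | zero => exact hψ
  | succ k ih =>
    intro z hz
    rw [pow_succ', mul_apply_eq_comp, der₂_apply]
    have h : (der₂ ^ k) ψ =ᶠ[nhds z] fun _ => 0 :=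
      Filter.eventually_of_mem (hK.isOpen_compl.mem_nhds hz) fun w hw => ih w hw
    rw [h.fderiv_eq]
    simp

theorem test_bound (T : Test2 →L[ℝ] Test2) (K : Compacts (ℝ × ℝ)) :
    ∃ (s : Finset ℕ) (C : ℝ), 0 ≤ C ∧ ∀ f : ContDiffMapSupportedIn (ℝ × ℝ) ℝ ⊤ K, ∀ z,
      |T (TestFunction.ofSupportedIn (Ω := (⊤ : Opens (ℝ × ℝ))) (fun _ _ => trivial) f) z| ≤
        C * (s.sup fun j => ContDiffMapSupportedIn.seminorm ℝ (ℝ × ℝ) ℝ ⊤ K j) f := by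
  let B : Test2 →L[ℝ] BoundedContinuousFunction (ℝ × ℝ) ℝ :=
    TestFunction.toBoundedContinuousFunctionCLM ℝ
  let I : ContDiffMapSupportedIn (ℝ × ℝ) ℝ ⊤ K →L[ℝ] Test2 :=
    TestFunction.ofSupportedInCLM ℝ (fun _ _ => trivial)
  let A := B ∘L T ∘L I
  obtain ⟨s, C, -, hC⟩ := Seminorm.bound_of_continuous
    (ContDiffMapSupportedIn.withSeminorms ℝ (ℝ × ℝ) ℝ ⊤ K)
    ((normSeminorm ℝ (BoundedContinuousFunction (ℝ × ℝ) ℝ)).comp A.toLinearMap)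
    (by exact A.continuous.norm)
  refine ⟨s, C, C.2, fun f z => ?_⟩
  exact (BoundedContinuousFunction.norm_coe_le_norm (A f) z).trans (hC f)

/-- The partial pairing `ψ ↦ (y ↦ S (ψ (·, y)))` as a continuous linear map. -/
def pairFstCLM (S : Dist1) : Test2 →L[ℝ] Test1 :=
  TestFunction.mkCLM ℝ (pairFst S)
    (fun f g => by
      ext y
      exact map_add S (slice f y) (slice g y))
    (fun c f => by
      ext y
      exact map_smul S c (slice f y))
    (fun K _ => by
      let K₁ : Compacts ℝ := ⟨Prod.fst '' (K : Set (ℝ × ℝ)), K.isCompact.image continuous_fst⟩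
      let K₂ : Compacts ℝ := ⟨Prod.snd '' (K : Set (ℝ × ℝ)), K.isCompact.image continuous_snd⟩
      let I : ContDiffMapSupportedIn (ℝ × ℝ) ℝ ⊤ K → Test2 :=
        TestFunction.ofSupportedIn (fun _ _ => trivial)
      have hI : ∀ f : ContDiffMapSupportedIn (ℝ × ℝ) ℝ ⊤ K, ∀ z ∉ (K : Set (ℝ × ℝ)), I f z = 0 :=
        fun f z hz => f.zero_on_compl hz
      let A : ContDiffMapSupportedIn (ℝ × ℝ) ℝ ⊤ K →ₗ[ℝ] ContDiffMapSupportedIn ℝ ℝ ⊤ K₂ :=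
        { toFun := fun f => ⟨pairFst S (I f), (pairFst S (I f)).contDiff, fun y hy =>
            apply_slice_eq_zero S (I f) fun x => hI f _ fun h => hy ⟨(x, y), h, rfl⟩⟩
          map_add' := fun f g => by
            ext y
            exact map_add S (slice (I f) y) (slice (I g) y)
          map_smul' := fun c f => by
            ext y
            exact map_smul S c (slice (I f) y) }
      have hA : Continuous A := by
        refine continuous_of_bound A fun k => ?_
        obtain ⟨n, C, hC0, hC⟩ := dist_bound S K₁
        choose s D hD0 hD using fun j : ℕ => test_bound (der₁ ^ j * der₂ ^ k) K
        let s' : Finset ℕ := (Finset.range (n + 1)).biUnion s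
        let D' : ℝ := ∑ j ∈ Finset.range (n + 1), D j
        have hD' : 0 ≤ D' := Finset.sum_nonneg fun j _ => hD0 j
        refine ⟨s', C * D', by positivity, fun f y _ => ?_⟩
        rw [norm_iteratedFDeriv_eq_norm_iteratedDeriv]
        have e : iteratedDeriv k (A f) y = S (slice ((der₂ ^ k) (I f)) y) :=
          congrFun (iteratedDeriv_apply_slice S (I f) k) y
        rw [e, mul_assoc]
        refine hC _ (fun x hx => ?_) _ (mul_nonneg hD' (apply_nonneg _ _)) fun j hj x => ?_
        · exact der₂_pow_eq_zero (I f) K.isCompact.isClosed (hI f) k (x, y)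
            fun h => hx ⟨(x, y), h, rfl⟩
        · rw [der_pow_slice]
          refine (hD j f (x, y)).trans ?_
          have hj' : j ∈ Finset.range (n + 1) := Finset.mem_range.2 (by omega)
          refine mul_le_mul (Finset.single_le_sum (f := D) (fun j _ => hD0 j) hj') ?_
            (apply_nonneg _ _) hD'
          exact Seminorm.le_def.1 (Finset.sup_mono (Finset.subset_biUnion_of_mem s hj')) f
      exact (TestFunction.continuous_ofSupportedIn (Ω := (⊤ : Opens ℝ)) (K := K₂)
        (fun _ _ => trivial)).comp hA)

theorem pairFstCLM_apply (S : Dist1) (ψ : Test2) (y : ℝ) :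
    pairFstCLM S ψ y = S (slice ψ y) := rfl

/-- The tensor product `S ⊗ T` of two distributions on the line, as a bilinear map:
`⟨S ⊗ T, ψ⟩ = ⟨T, y ↦ ⟨S, ψ (·, y)⟩⟩`. -/
def tensor : Dist1 →ₗ[ℝ] Dist1 →ₗ[ℝ] Dist2 :=
  LinearMap.mk₂ ℝ (fun S T => (pairFstCLM S).precompCompactConvergenceCLM ℝ T)
    (fun S S' T => by
      ext ψ
      change T (pairFstCLM (S + S') ψ) = T (pairFstCLM S ψ) + T (pairFstCLM S' ψ)
      rw [← map_add]
      rfl)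
    (fun c S T => by
      ext ψ
      change T (pairFstCLM (c • S) ψ) = c • T (pairFstCLM S ψ)
      rw [← map_smul]
      rfl)
    (fun S T T' => map_add _ T T')
    (fun c S T => map_smul _ c T)

theorem tensor_apply (S T : Dist1) (ψ : Test2) : tensor S T ψ = T (pairFstCLM S ψ) := rfl

/-- The defining property of the tensor product of distributions. -/
theorem tensor_tensorTest (S T : Dist1) (φ₁ φ₂ : Test1) :
    tensor S T (tensorTest φ₁ φ₂) = S φ₁ * T φ₂ := by
  have h : pairFstCLM S (tensorTest φ₁ φ₂) = S φ₁ • φ₂ := by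
    ext y
    have hs : slice (tensorTest φ₁ φ₂) y = φ₂ y • φ₁ := by
      ext x
      simp [slice_apply, tensorTest_apply, mul_comm]
    rw [pairFstCLM_apply, hs, map_smul]
    simp [mul_comm]
  rw [tensor_apply, h, map_smul, smul_eq_mul]

/-- `⟨T, φ⟩` in the first variable: the distribution `ψ ↦ ⟨T, φ ⊗ ψ⟩`. -/
def evalFst (φ : Test1) : Dist2 →L[ℝ] Dist1 :=
  (tensorTestLeft φ).precompCompactConvergenceCLM ℝ

/-- `⟨T, φ⟩` in the second variable: the distribution `ψ ↦ ⟨T, ψ ⊗ φ⟩`. -/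
def evalSnd (φ : Test1) : Dist2 →L[ℝ] Dist1 :=
  (tensorTestRight φ).precompCompactConvergenceCLM ℝ

/-! ### Functions and bounded measures as distributions -/

/-- The distribution `ψ ↦ ∫ ψ f` of a locally integrable function `f`. -/
def ofFun {E : Type} [NormedAddCommGroup E] [NormedSpace ℝ E] [MeasureSpace E] [BorelSpace E]
    (f : E → ℝ) : Distribution (⊤ : Opens E) ℝ ⊤ :=
  TestFunction.integralAgainstBilinCLM (ContinuousLinearMap.mul ℝ ℝ) volume f

theorem ofFun_apply {E : Type} [NormedAddCommGroup E] [NormedSpace ℝ E] [MeasureSpace E] [BorelSpace E]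
    {f : E → ℝ} (hf : LocallyIntegrable f volume)
    (ψ : TestFunction (⊤ : Opens E) ℝ ⊤) : ofFun f ψ = ∫ x, ψ x * f x :=
  TestFunction.integralAgainstBilinCLM_eq_integral (hf.locallyIntegrableOn _)

theorem integrable_test {E : Type} [NormedAddCommGroup E] [NormedSpace ℝ E] [MeasurableSpace E] [BorelSpace E] (m : SignedMeasure E)
    (ψ : TestFunction (⊤ : Opens E) ℝ ⊤) : m.Integrable ψ := by
  have : IsFiniteMeasure m.variation := by
    rw [← SignedMeasure.totalVariation_eq_variation]; infer_instance
  exact ψ.continuous.integrable_of_hasCompactSupport ψ.hasCompactSupport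

/-- The distribution `ψ ↦ ∫ ψ dm` of a bounded (signed Borel) measure `m`. -/
def ofMeasure {E : Type} [NormedAddCommGroup E] [NormedSpace ℝ E] [MeasurableSpace E] [BorelSpace E]
    (m : SignedMeasure E) : Distribution (⊤ : Opens E) ℝ ⊤ :=
  (TestFunction.mkCLM ℝ (fun ψ : TestFunction (⊤ : Opens E) ℝ ⊤ => ∫ᵛ x, ψ x ∂•m)
    (fun f g => VectorMeasure.integral_fun_add (integrable_test m f) (integrable_test m g))
    (fun c f => VectorMeasure.integral_fun_smul m _ c f)
    (fun K _ => by
      have hm : IsFiniteMeasure m.variation := by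
        rw [← SignedMeasure.totalVariation_eq_variation]; infer_instance
      let A : ContDiffMapSupportedIn E ℝ ⊤ K →L[ℝ] ℝ :=
        ContDiffMapSupportedIn.mkCLMtoNormedSpace ℝ
          (fun ψ => ∫ᵛ x, ψ x ∂•m)
          (fun f g => VectorMeasure.integral_fun_add
            (integrable_test m (TestFunction.ofSupportedIn (fun _ _ => trivial) f))
            (integrable_test m (TestFunction.ofSupportedIn (fun _ _ => trivial) g)))
          (fun c f => VectorMeasure.integral_fun_smul m _ c f)
          ⟨{0}, ‖(ContinuousLinearMap.lsmul ℝ ℝ : ℝ →L[ℝ] ℝ →L[ℝ] ℝ)‖ * m.variation.real univ,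
            by positivity, fun f => by
              refine VectorMeasure.norm_integral_le_integral_norm.trans ?_
              rw [mul_assoc]
              refine mul_le_mul_of_nonneg_left ?_ (ContinuousLinearMap.opNorm_nonneg _)
              rw [mul_comm]
              refine (Real.le_norm_self _).trans (norm_integral_le_of_norm_le_const
                (Filter.Eventually.of_forall fun x => ?_))
              rw [norm_norm, Finset.sup_singleton]
              exact ContDiffMapSupportedIn.norm_apply_le_seminorm ℝ⟩
      exact A.continuous) : TestFunction (⊤ : Opens E) ℝ ⊤ →L[ℝ] ℝ)

theorem ofMeasure_apply {E : Type} [NormedAddCommGroup E] [NormedSpace ℝ E] [MeasurableSpace E] [BorelSpace E]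
    (m : SignedMeasure E) (ψ : TestFunction (⊤ : Opens E) ℝ ⊤) :
    ofMeasure m ψ = ∫ᵛ x, ψ x ∂•m := rfl

/-! ### One-dimensional theory for `L = (D - α I) ^ N` -/

/-- The operator `(∂_v - α I) ^ N` acting on distributions. -/
def diffOp {E : Type} [NormedAddCommGroup E] [NormedSpace ℝ E] (v : E) (α : ℝ) (N : ℕ) :
    Module.End ℝ (Distribution (⊤ : Opens E) ℝ ⊤) :=
  ((Distribution.lineDerivCLM v : Distribution (⊤ : Opens E) ℝ ⊤ →L[ℝ]
      Distribution (⊤ : Opens E) ℝ ⊤).toLinearMap - α • LinearMap.id) ^ N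

/-- The operator `L = (D - α I) ^ N` on distributions on the line. -/
def ode (α : ℝ) (N : ℕ) : Module.End ℝ Dist1 := diffOp (1 : ℝ) α N

/-- The null space `N_L` of `L`, in the space of distributions. -/
def nullSpace (α : ℝ) (N : ℕ) : Submodule ℝ Dist1 := LinearMap.ker (ode α N)

/-- The causal Green's function `t ↦ t₊ ^ (N - 1) e ^ (α t) / (N - 1)!` of `L`. -/
def greenFun (α : ℝ) (N : ℕ) (t : ℝ) : ℝ :=
  if 0 ≤ t then t ^ (N - 1) * Real.exp (α * t) / ((N - 1).factorial : ℝ) else 0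

/-- `(p, φ)` is a universal `L`-admissible system: `p` is a basis of the null space of `L`
(given by continuous representatives), the `φ n` are test functions, and the two families are
biorthogonal. -/
structure IsAdmissible (α : ℝ) (N : ℕ) (p : Fin N → ℝ → ℝ) (φ : Fin N → Test1) : Prop where
  continuous : ∀ n, Continuous (p n)
  linearIndependent : LinearIndependent ℝ fun n => (ofFun (p n) : Dist1)
  span_eq : Submodule.span ℝ (range fun n => (ofFun (p n) : Dist1)) = nullSpace α N
  biorthogonal : ∀ n m, ∫ t, p n t * φ m t = if n = m then 1 else 0

/-- The kernel `g_φ(t, x) = g_L(t - x) - ∑ₙ ⟨g_L, φₙ(· + x)⟩ pₙ(t)`. -/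
def kernel (α : ℝ) {N : ℕ} (p : Fin N → ℝ → ℝ) (φ : Fin N → Test1) (t x : ℝ) : ℝ :=
  greenFun α N (t - x) - ∑ n, (∫ s, greenFun α N s * φ n (s + x)) * p n t

/-- The function `L_φ⁻¹ m = ∫ g_φ(·, x) dm(x)`. -/
def inv1 (α : ℝ) {N : ℕ} (p : Fin N → ℝ → ℝ) (φ : Fin N → Test1) (m : SignedMeasure ℝ) :
    ℝ → ℝ :=
  fun t => ∫ᵛ x, kernel α p φ t x ∂•m

/-- The projector `f ↦ ∑ₙ ⟨f, φₙ⟩ pₙ` onto the null space. -/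
def projNull {N : ℕ} (p : Fin N → ℝ → ℝ) (φ : Fin N → Test1) : Module.End ℝ Dist1 where
  toFun f := ∑ n, f (φ n) • ofFun (p n)
  map_add' f g := by
    rw [← Finset.sum_add_distrib]
    exact Finset.sum_congr rfl fun n _ => add_smul (f (φ n)) (g (φ n)) _
  map_smul' c f := by
    rw [Finset.smul_sum]
    exact Finset.sum_congr rfl fun n _ => mul_smul c (f (φ n)) _

/-- The distributions `∫ g_φ(·, x) dm(x)`, `m` a bounded measure on the line. -/
def invSpace (α : ℝ) {N : ℕ} (p : Fin N → ℝ → ℝ) (φ : Fin N → Test1) : Submodule ℝ Dist1 :=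
  Submodule.span ℝ (range fun m : SignedMeasure ℝ => ofFun (inv1 α p φ m))

/-! ### Two-dimensional theory -/

section Plane

variable (α₁ α₂ : ℝ) {N₁ N₂ : ℕ} (p₁ : Fin N₁ → ℝ → ℝ) (φ₁ : Fin N₁ → Test1)
  (p₂ : Fin N₂ → ℝ → ℝ) (φ₂ : Fin N₂ → Test1)

/-- The function `(L_φ₁⁻¹ ⊗ L_φ₂⁻¹) m = ∫ g_φ₁(·, x₁) g_φ₂(·, x₂) dm(x₁, x₂)`. -/
def inv2 (m : SignedMeasure (ℝ × ℝ)) : ℝ × ℝ → ℝ :=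
  fun t => ∫ᵛ x, kernel α₁ p₁ φ₁ t.1 x.1 * kernel α₂ p₂ φ₂ t.2 x.2 ∂•m

/-- The four components of the native space, in order: `(L_φ₁⁻¹ ⊗ L_φ₂⁻¹) M(ℝ²)`,
`N_L₁ ⊗ L_φ₂⁻¹ M(ℝ)`, `L_φ₁⁻¹ M(ℝ) ⊗ N_L₂` and `N_L₁ ⊗ N_L₂`. For subspaces `U`, `V` of
distributions, `U ⊗ V` is the span of the `u ⊗ v` with `u ∈ U` and `v ∈ V`. -/
def component : Fin 4 → Submodule ℝ Dist2 :=
  ![Submodule.span ℝ (range fun m : SignedMeasure (ℝ × ℝ) => ofFun (inv2 α₁ α₂ p₁ φ₁ p₂ φ₂ m)),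
    Submodule.map₂ tensor (nullSpace α₁ N₁) (invSpace α₂ p₂ φ₂),
    Submodule.map₂ tensor (invSpace α₁ p₁ φ₁) (nullSpace α₂ N₂),
    Submodule.map₂ tensor (nullSpace α₁ N₁) (nullSpace α₂ N₂)]

/-- The native space: the sum of the four components. -/
def native : Submodule ℝ Dist2 := ⨆ i, component α₁ α₂ p₁ φ₁ p₂ φ₂ i

/-- `∑ₙ p₁ₙ ⊗ Sₙ`. -/
def sumLeft (S : Fin N₁ → Dist1) : Dist2 := ∑ n, tensor (ofFun (p₁ n)) (S n)

/-- `∑ₙ Sₙ ⊗ p₂ₙ`. -/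
def sumRight (S : Fin N₂ → Dist1) : Dist2 := ∑ n, tensor (S n) (ofFun (p₂ n))

/-- `∑ₙₙ' dₙₙ' p₁ₙ ⊗ p₂ₙ'`. -/
def sumBoth (d : Matrix (Fin N₁) (Fin N₂) ℝ) : Dist2 :=
  ∑ n, ∑ n', d n n' • tensor (ofFun (p₁ n)) (ofFun (p₂ n'))

/-- The four summands of the representation of an element of the native space by
measures `m`, `m₁`, `m₂` and a matrix `d`. -/
def summand (m : SignedMeasure (ℝ × ℝ)) (m₁ : Fin N₁ → SignedMeasure ℝ)
    (m₂ : Fin N₂ → SignedMeasure ℝ) (d : Matrix (Fin N₁) (Fin N₂) ℝ) : Fin 4 → Dist2 :=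
  ![ofFun (inv2 α₁ α₂ p₁ φ₁ p₂ φ₂ m),
    sumLeft p₁ fun n => ofFun (inv1 α₂ p₂ φ₂ (m₁ n)),
    sumRight p₂ fun n => ofFun (inv1 α₁ p₁ φ₁ (m₂ n)),
    sumBoth p₁ p₂ d]

/-- The distribution `(L_φ₁⁻¹ ⊗ L_φ₂⁻¹) m + ∑ₙ p₁ₙ ⊗ L_φ₂⁻¹ m₁ₙ + ∑ₙ L_φ₁⁻¹ m₂ₙ ⊗ p₂ₙ +
∑ₙₙ' dₙₙ' p₁ₙ ⊗ p₂ₙ'`. -/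
def synth (m : SignedMeasure (ℝ × ℝ)) (m₁ : Fin N₁ → SignedMeasure ℝ)
    (m₂ : Fin N₂ → SignedMeasure ℝ) (d : Matrix (Fin N₁) (Fin N₂) ℝ) : Dist2 :=
  ∑ i, summand α₁ α₂ p₁ φ₁ p₂ φ₂ m m₁ m₂ d i

/-- The operator `L₁ ⊗ L₂ = (∂₁ - α₁) ^ N₁ (∂₂ - α₂) ^ N₂` on distributions on the plane. -/
def opLL (N₁ N₂ : ℕ) : Module.End ℝ Dist2 :=
  diffOp ((1, 0) : ℝ × ℝ) α₁ N₁ * diffOp ((0, 1) : ℝ × ℝ) α₂ N₂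

/-- The operator `proj ⊗ B`, where `proj` is the projector onto the null space in the first
variable: `f ↦ ∑ₙ p₁ₙ ⊗ B ⟨f, φ₁ₙ⟩₁`. -/
def opProjFst (B : Module.End ℝ Dist1) : Module.End ℝ Dist2 :=
  ∑ n, tensor (ofFun (p₁ n)) ∘ₗ B ∘ₗ (evalFst (φ₁ n)).toLinearMap

/-- The operator `A ⊗ proj`, where `proj` is the projector onto the null space in the second
variable: `f ↦ ∑ₙ A ⟨f, φ₂ₙ⟩₂ ⊗ p₂ₙ`. -/
def opProjSnd (A : Module.End ℝ Dist1) : Module.End ℝ Dist2 :=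
  ∑ n, tensor.flip (ofFun (p₂ n)) ∘ₗ A ∘ₗ (evalSnd (φ₂ n)).toLinearMap

/-- The operators `L₁ ⊗ L₂`, `proj₁ ⊗ L₂`, `L₁ ⊗ proj₂` and `proj₁ ⊗ proj₂`. -/
def analysisOp : Fin 4 → Module.End ℝ Dist2 :=
  ![opLL α₁ α₂ N₁ N₂, opProjFst p₁ φ₁ (ode α₂ N₂), opProjSnd p₂ φ₂ (ode α₁ N₁),
    opProjFst p₁ φ₁ (projNull p₂ φ₂)]

/-- The first factors `L₁, proj₁, L₁, proj₁` of the four operators. -/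
def fstFactor : Fin 4 → Module.End ℝ Dist1 :=
  ![ode α₁ N₁, projNull p₁ φ₁, ode α₁ N₁, projNull p₁ φ₁]

/-- The second factors `L₂, L₂, proj₂, proj₂` of the four operators. -/
def sndFactor : Fin 4 → Module.End ℝ Dist1 :=
  ![ode α₂ N₂, ode α₂ N₂, projNull p₂ φ₂, projNull p₂ φ₂]

/-- The norm of `M(ℝ²)`, i.e. the total variation, as an extended norm on distributions
(infinite off `M(ℝ²)`). -/
def measNorm (T : Dist2) : ℝ≥0∞ :=
  ⨅ (m : SignedMeasure (ℝ × ℝ)) (_ : ofMeasure m = T), m.variation univ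

/-- The norm `‖∑ₙ p₁ₙ ⊗ mₙ‖ = ∑ₙ ‖mₙ‖` of `N_L₁ ⊗ M(ℝ)`, infinite off that space. -/
def leftNorm (T : Dist2) : ℝ≥0∞ :=
  ⨅ (m : Fin N₁ → SignedMeasure ℝ) (_ : sumLeft p₁ (fun n => ofMeasure (m n)) = T),
    ∑ n, (m n).variation univ

/-- The norm `‖∑ₙ mₙ ⊗ p₂ₙ‖ = ∑ₙ ‖mₙ‖` of `M(ℝ) ⊗ N_L₂`, infinite off that space. -/
def rightNorm (T : Dist2) : ℝ≥0∞ :=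
  ⨅ (m : Fin N₂ → SignedMeasure ℝ) (_ : sumRight p₂ (fun n => ofMeasure (m n)) = T),
    ∑ n, (m n).variation univ

/-- The norm `‖∑ₙₙ' dₙₙ' p₁ₙ ⊗ p₂ₙ'‖ = ∑ₙₙ' |dₙₙ'|` of `N_L₁ ⊗ N_L₂`, infinite off that
space. -/
def bothNorm (T : Dist2) : ℝ≥0∞ :=
  ⨅ (d : Matrix (Fin N₁) (Fin N₂) ℝ) (_ : sumBoth p₁ p₂ d = T), ∑ n, ∑ n', ‖d n n'‖ₑ

/-- The norms of the ranges of the four operators. -/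
def rangeNorm : Fin 4 → Dist2 → ℝ≥0∞ :=
  ![measNorm, leftNorm p₁, rightNorm p₂, bothNorm p₁ p₂]

/-- The native norm
`‖(L₁ ⊗ L₂) f‖ + ‖(proj₁ ⊗ L₂) f‖ + ‖(L₁ ⊗ proj₂) f‖ + ‖(proj₁ ⊗ proj₂) f‖`. -/
def nativeNorm (f : Dist2) : ℝ≥0∞ :=
  ∑ i, rangeNorm p₁ p₂ i (analysisOp α₁ α₂ p₁ φ₁ p₂ φ₂ i f)

end Plane

/-- A seminorm `ν` on `V` is a norm for which `V` is complete. -/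
def IsBanachNorm {V : Type} [AddCommGroup V] [Module ℝ V] (ν : Seminorm ℝ V) : Prop :=
  (∀ f, ν f = 0 → f = 0) ∧
    ∀ u : ℕ → V, (∀ ε > 0, ∃ K, ∀ i ≥ K, ∀ j ≥ K, ν (u i - u j) < ε) →
      ∃ f, Filter.Tendsto (fun i => ν (u i - f)) Filter.atTop (nhds 0)

end TensorSpline

end

open TensorSpline

/-! Four analysis operators are biorthogonal to four synthesis maps. On the line, `L` kills the null
space and is a left inverse of `L_φ⁻¹`, while the projector fixes the null space and kills the range
of `L_φ⁻¹` (`ode_inv1`, `projNull_inv1`, `ode_ofFun`, `projNull_ofFun`). The two facts about `L_φ⁻¹`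
come from its kernel: `g_φ(·, x)` is `I - proj` applied to the translated Green's function, so `L
g_φ(·, x) = δ_x` and `⟨g_φ(·, x), φ_n⟩ = 0`. On the plane, the operator with index `i` therefore
sends the component with index `j` to its parameters if `i = j` and to zero otherwise
(`analysisOp_part`). The parameters can be read off from these values (`target_injective`), because
a bounded measure is determined by its distribution and the `p_n` are independent and biorthogonal
to the `φ_n`. Directness of the sum and uniqueness of the representation follow. Synthesis becomes a
linear bijection from the parameters onto the native space, and the native norm is the transported
`ℓ¹` sum of total variations and absolute values. Its completeness is that of the space of bounded
measures (`exists_tendsto_of_cauchy_tv`).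

Two analytic points carry the argument. First, integration against an arbitrary bounded measure
needs `g_φ(t, x)` bounded in `x`, locally uniformly in `t` (`isLocBddKernel`). For `t` in a compact
set and `|x|` large, the translated Green's function agrees, on that set and on the supports of the
`φ_n`, either with zero or with an element of the null space; `I - proj` annihilates both. Fubini
(`ofFun_integral`) then moves operators under the integral.

Second, `tensor` pairs its first factor before its second, so continuity of `S ↦ S ⊗ p` is not
immediate. It follows from a Fubini theorem for a distribution and a function
(`tensor_ofFun_apply`), proved by realizing the distribution, on a compact set, as a continuous
functional on a Banach space of jets. -/

noncomputable section

namespace TensorSpline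

/-! ### Integration against signed measures -/

section SignedMeasures

variable {X : Type} [MeasurableSpace X]

instance isFiniteMeasure_variation (m : SignedMeasure X) : IsFiniteMeasure m.variation := by
  rw [← SignedMeasure.totalVariation_eq_variation]; infer_instance

theorem integrable_posPart {m : SignedMeasure X} {f : X → ℝ} (hf : m.Integrable f) :
    Integrable f m.toJordanDecomposition.posPart := by
  refine Integrable.mono_measure hf ?_
  rw [← SignedMeasure.totalVariation_eq_variation]
  exact Measure.le_add_right le_rfl

theorem integrable_negPart {m : SignedMeasure X} {f : X → ℝ} (hf : m.Integrable f) :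
    Integrable f m.toJordanDecomposition.negPart := by
  refine Integrable.mono_measure hf ?_
  rw [← SignedMeasure.totalVariation_eq_variation]
  exact Measure.le_add_left le_rfl

/-- The integral is additive in the measure, so it splits along the Jordan decomposition. This opens
the way to Fubini and to measurability of parametric integrals for positive measures. -/
theorem integral_signedMeasure {m : SignedMeasure X} {f : X → ℝ} (hf : m.Integrable f) :
    ∫ᵛ x, f x ∂•m =
      ∫ x, f x ∂m.toJordanDecomposition.posPart - ∫ x, f x ∂m.toJordanDecomposition.negPart := by
  have hB : (ContinuousLinearMap.lsmul ℝ ℝ : ℝ →L[ℝ] ℝ →L[ℝ] ℝ).flip =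
      ContinuousLinearMap.lsmul ℝ ℝ := by
    ext; simp
  have h := VectorMeasure.integral_sub_vectorMeasure (f := f)
    (B := (ContinuousLinearMap.lsmul ℝ ℝ : ℝ →L[ℝ] ℝ →L[ℝ] ℝ).flip)
    (μ := m.toJordanDecomposition.posPart.toSignedMeasure)
    (ν := m.toJordanDecomposition.negPart.toSignedMeasure)
    (by simpa [VectorMeasure.Integrable] using integrable_posPart hf)
    (by simpa [VectorMeasure.Integrable] using integrable_negPart hf)
  rw [VectorMeasure.integral_toSignedMeasure, VectorMeasure.integral_toSignedMeasure, hB] at h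
  rw [← h]
  conv_lhs => rw [← m.toSignedMeasure_toJordanDecomposition]
  rfl

theorem integrable_of_bound {m : SignedMeasure X} {f : X → ℝ} (hf : Measurable f) {C : ℝ}
    (hC : ∀ x, |f x| ≤ C) : m.Integrable f :=
  Integrable.of_bound hf.aestronglyMeasurable C (Filter.Eventually.of_forall hC)

end SignedMeasures

/-! ### Injectivity of the embeddings into distributions -/

section Injectivity

variable {E : Type} [NormedAddCommGroup E] [NormedSpace ℝ E] [MeasurableSpace E] [BorelSpace E]

theorem ofMeasure_add (m m' : SignedMeasure E) :
    (ofMeasure (m + m') : Distribution (⊤ : Opens E) ℝ ⊤) = ofMeasure m + ofMeasure m' := by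
  ext ψ
  exact VectorMeasure.integral_add_vectorMeasure (integrable_test m ψ) (integrable_test m' ψ)

theorem ofMeasure_smul (c : ℝ) (m : SignedMeasure E) :
    (ofMeasure (c • m) : Distribution (⊤ : Opens E) ℝ ⊤) = c • ofMeasure m := by
  ext ψ
  exact VectorMeasure.integral_smul_vectorMeasure _ _

variable [FiniteDimensional ℝ E]

/-- The Hahn decomposition gives a density `s = ±1` of `m` with respect to its total variation `μ +
ν`, and `∫ g dm = ∫ g s d(μ + ν)`. If this vanishes for all test functions, then `s = 0` almost
everywhere; as `s` has no zero, `μ + ν = 0`. -/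
theorem eq_zero_of_ofMeasure_eq_zero {m : SignedMeasure E}
    (h : (ofMeasure m : Distribution (⊤ : Opens E) ℝ ⊤) = 0) : m = 0 := by
  classical
  obtain ⟨S, hS, -, -, hpos, hneg⟩ := m.toJordanDecomposition.exists_compl_positive_negative
  set μ := m.toJordanDecomposition.posPart
  set ν := m.toJordanDecomposition.negPart
  let s : E → ℝ := fun x => if x ∈ S then -1 else 1
  have hs : Measurable s := Measurable.ite hS measurable_const measurable_const
  have hμ : s =ᵐ[μ] fun _ => 1 := by
    filter_upwards [compl_mem_ae_iff.2 hpos] with x hx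
    exact if_neg hx
  have hν : s =ᵐ[ν] fun _ => -1 := by
    filter_upwards [mem_ae_iff.2 hneg] with x hx
    exact if_pos hx
  have key : ∀ᵐ x ∂(μ + ν), s x = 0 := by
    refine ae_eq_zero_of_integral_contDiff_smul_eq_zero
      (Integrable.of_bound hs.aestronglyMeasurable 1 (Filter.Eventually.of_forall fun x => ?_)).locallyIntegrable
      fun g hg hgc => ?_
    · by_cases hx : x ∈ S <;> simp [s, hx]
    · let ψ : TestFunction (⊤ : Opens E) ℝ ⊤ := ⟨g, hg, hgc, fun _ _ => trivial⟩
      have hi : m.Integrable g := integrable_test m ψ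
      have h1 : ∫ᵛ x, g x ∂•m = 0 := by
        have := ofMeasure_apply m ψ
        rw [h] at this
        exact this.symm
      rw [integral_signedMeasure hi] at h1
      have e₁ : (fun x => g x • s x) =ᵐ[μ] g := by
        filter_upwards [hμ] with x hx; simp [hx]
      have e₂ : (fun x => g x • s x) =ᵐ[ν] fun x => -g x := by
        filter_upwards [hν] with x hx; simp [hx]
      rw [integral_add_measure ((integrable_posPart hi).congr e₁.symm)
        ((integrable_negPart hi).neg.congr e₂.symm), integral_congr_ae e₁, integral_congr_ae e₂,
        integral_neg]
      exact h1
  have hz : μ + ν = 0 := by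
    rw [← Measure.measure_univ_eq_zero]
    rw [ae_iff] at key
    convert key
    refine (eq_univ_of_forall fun x => ?_).symm
    by_cases hx : x ∈ S <;> simp [s, hx]
  have hv : m.variation = 0 := by
    rw [← SignedMeasure.totalVariation_eq_variation]; exact hz
  ext i hi
  have := VectorMeasure.enorm_measure_le_variation m i
  rw [hv] at this
  simpa using this

theorem ofMeasure_injective :
    Function.Injective (ofMeasure : SignedMeasure E → Distribution (⊤ : Opens E) ℝ ⊤) := by
  intro m m' h
  rw [← sub_eq_zero]
  refine eq_zero_of_ofMeasure_eq_zero ?_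
  rw [sub_eq_add_neg, ← neg_one_smul ℝ m', ofMeasure_add, ofMeasure_smul, h]
  simp

end Injectivity

theorem eq_of_ofFun_eq {E : Type} [NormedAddCommGroup E] [NormedSpace ℝ E] [FiniteDimensional ℝ E]
    [MeasureSpace E] [BorelSpace E] [(volume : Measure E).IsOpenPosMeasure]
    [IsLocallyFiniteMeasure (volume : Measure E)] {f g : E → ℝ}
    (hf : Continuous f) (hg : Continuous g)
    (h : (ofFun f : Distribution (⊤ : Opens E) ℝ ⊤) = ofFun g) : f = g := by
  refine (hf.ae_eq_iff_eq volume hg).1 (ae_eq_of_integral_contDiff_smul_eq hf.locallyIntegrable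
    hg.locallyIntegrable fun φ hφ hc => ?_)
  let ψ : TestFunction (⊤ : Opens E) ℝ ⊤ := ⟨φ, hφ, hc, fun _ _ => trivial⟩
  have := congrArg (fun T => T ψ) h
  simp only [ofFun_apply hf.locallyIntegrable, ofFun_apply hg.locallyIntegrable] at this
  exact this

/-! ### Locally bounded kernels and Fubini -/

section Kernels

variable {E : Type} [NormedAddCommGroup E] [MeasureSpace E]

/-- A measurable kernel that is bounded, locally uniformly in its first variable. -/
structure IsLocBddKernel (K : E → E → ℝ) : Prop where
  measurable : Measurable (Function.uncurry K)
  bound : ∀ B : Set E, IsCompact B → ∃ C : ℝ, ∀ t ∈ B, ∀ x, |K t x| ≤ C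

variable {K : E → E → ℝ}

theorem IsLocBddKernel.integrable (hK : IsLocBddKernel K) (m : SignedMeasure E) (t : E) :
    m.Integrable (K t) := by
  obtain ⟨C, hC⟩ := hK.bound {t} isCompact_singleton
  exact integrable_of_bound (hK.measurable.comp measurable_prodMk_left) (hC t rfl)

variable [NormedSpace ℝ E] [FiniteDimensional ℝ E] [BorelSpace E]
  [IsLocallyFiniteMeasure (volume : Measure E)]

theorem locallyIntegrable_of_bound {f : E → ℝ} (hf : Measurable f)
    (h : ∀ B : Set E, IsCompact B → ∃ C : ℝ, ∀ t ∈ B, |f t| ≤ C) : LocallyIntegrable f volume := by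
  rw [locallyIntegrable_iff]
  intro B hB
  obtain ⟨C, hC⟩ := h B hB
  refine IntegrableOn.of_bound hB.measure_lt_top hf.aestronglyMeasurable C ?_
  exact (ae_restrict_iff' hB.measurableSet).2 (Filter.Eventually.of_forall hC)

theorem IsLocBddKernel.locallyIntegrable_left (hK : IsLocBddKernel K) (x : E) :
    LocallyIntegrable (fun t => K t x) volume := by
  refine locallyIntegrable_of_bound (hK.measurable.comp measurable_prodMk_right) fun B hB => ?_
  obtain ⟨C, hC⟩ := hK.bound B hB
  exact ⟨C, fun t ht => hC t ht x⟩

theorem IsLocBddKernel.locallyIntegrable_integral (hK : IsLocBddKernel K) (m : SignedMeasure E) :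
    LocallyIntegrable (fun t => ∫ᵛ x, K t x ∂•m) volume := by
  refine locallyIntegrable_of_bound ?_ fun B hB => ?_
  · simp_rw [fun t => integral_signedMeasure (hK.integrable m t)]
    exact (hK.measurable.stronglyMeasurable.integral_prod_right'.measurable).sub
      (hK.measurable.stronglyMeasurable.integral_prod_right'.measurable)
  · obtain ⟨C, hC⟩ := hK.bound B hB
    exact ⟨C * ‖(ContinuousLinearMap.lsmul ℝ ℝ : ℝ →L[ℝ] ℝ →L[ℝ] ℝ)‖ * m.variation.real univ,
      fun t ht => (Real.norm_eq_abs _).symm.le.trans <|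
        VectorMeasure.norm_integral_le_of_norm_le_const
        (Filter.Eventually.of_forall (hC t ht))⟩

/-- On the support of `ψ` the kernel is bounded uniformly in `x`, so `ψ t * K t x` is integrable for
the product of `volume` with any finite measure, in particular with the two Jordan parts. Operations
defined by duality can thus be carried out under the integral in `x`. -/
theorem IsLocBddKernel.ofFun_integral (hK : IsLocBddKernel K) (m : SignedMeasure E)
    (ψ : TestFunction (⊤ : Opens E) ℝ ⊤) :
    m.Integrable (fun x => ofFun (fun t => K t x) ψ) ∧
    ofFun (fun t => ∫ᵛ x, K t x ∂•m) ψ = ∫ᵛ x, ofFun (fun t => K t x) ψ ∂•m := by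
  obtain ⟨C, hC⟩ := hK.bound (tsupport ψ) ψ.hasCompactSupport
  have hψ : Integrable ψ volume := ψ.continuous.integrable_of_hasCompactSupport ψ.hasCompactSupport
  have hm : Measurable fun z : E × E => ψ z.1 * K z.1 z.2 :=
    (ψ.continuous.measurable.comp measurable_fst).mul hK.measurable
  have hb : ∀ z : E × E, ‖ψ z.1 * K z.1 z.2‖ ≤ ‖ψ z.1‖ * C := by
    intro z
    rw [norm_mul]
    by_cases hz : z.1 ∈ tsupport ψ
    · exact mul_le_mul_of_nonneg_left (hC _ hz _) (norm_nonneg _)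
    · simp [image_eq_zero_of_notMem_tsupport hz]
  have hint : ∀ μ : Measure E, IsFiniteMeasure μ →
      Integrable (fun z : E × E => ψ z.1 * K z.1 z.2) (volume.prod μ) := fun μ _ =>
    ((hψ.norm.mul_const C).comp_fst μ).mono' hm.aestronglyMeasurable
      (Filter.Eventually.of_forall hb)
  have hi : m.Integrable (fun x => ∫ t, ψ t * K t x) :=
    (hint m.variation inferInstance).integral_prod_right
  simp_rw [fun x => ofFun_apply (hK.locallyIntegrable_left x) ψ]
  refine ⟨hi, ?_⟩
  have hp := hint m.toJordanDecomposition.posPart inferInstance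
  have hn := hint m.toJordanDecomposition.negPart inferInstance
  rw [ofFun_apply (hK.locallyIntegrable_integral m), integral_signedMeasure hi,
    ← integral_integral_swap (f := fun t x => ψ t * K t x) hp,
    ← integral_integral_swap (f := fun t x => ψ t * K t x) hn,
    ← integral_sub hp.integral_prod_left hn.integral_prod_left]
  refine integral_congr_ae (Filter.Eventually.of_forall fun t => ?_)
  simp only [integral_const_mul, integral_signedMeasure (hK.integrable m t), mul_sub]

end Kernels

/-! ### Completeness of the total variation norm -/

section Completeness

variable {X : Type} [MeasurableSpace X]

/-- The total variation as a real number. -/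
def tv (m : SignedMeasure X) : ℝ := m.variation.real univ

theorem tv_nonneg (m : SignedMeasure X) : 0 ≤ tv m := measureReal_nonneg

theorem ofReal_tv (m : SignedMeasure X) : ENNReal.ofReal (tv m) = m.variation univ :=
  ofReal_measureReal

theorem tv_add_le (m m' : SignedMeasure X) : tv (m + m') ≤ tv m + tv m' := by
  unfold tv
  rw [← measureReal_add_apply]
  exact ENNReal.toReal_mono (by finiteness) (VectorMeasure.variation_add_le univ)

theorem tv_smul (c : ℝ) (m : SignedMeasure X) : tv (c • m) = ‖c‖ * tv m := by
  unfold tv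
  rw [VectorMeasure.variation_smul, measureReal_nnreal_smul_apply, coe_nnnorm]

theorem eq_zero_of_tv_eq_zero {m : SignedMeasure X} (h : tv m = 0) : m = 0 := by
  ext i hi
  have h1 : ‖m i‖ ≤ tv m :=
    (VectorMeasure.norm_measure_le_variation).trans (measureReal_mono (subset_univ i))
  rw [h] at h1
  simpa using h1

theorem norm_apply_le_tv (m : SignedMeasure X) (i : Set X) : ‖m i‖ ≤ tv m :=
  (VectorMeasure.norm_measure_le_variation).trans (measureReal_mono (subset_univ i))

/-- The variation is a supremum over finite disjoint measurable families: if it exceeded `C`, one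
such family would already do so. -/
theorem tv_le_of_forall_sum_le {m : SignedMeasure X} {C : ℝ} 
    (h : ∀ P : Finset (Set X), ((P : Set (Set X)).PairwiseDisjoint id) →
      (∀ t ∈ P, MeasurableSet t) → ∑ p ∈ P, ‖m p‖ ≤ C) : tv m ≤ C := by
  by_contra! hC
  have hC0 : 0 ≤ C := by simpa using h ∅ (by simp) (by simp)
  have h1 : ENNReal.ofReal C < m.variation univ := by
    rw [← ofReal_tv]
    exact (ENNReal.ofReal_lt_ofReal_iff_of_nonneg hC0).2 hC
  obtain ⟨P, -, hd, hm, hlt⟩ := VectorMeasure.exists_lt_sum_of_lt_variation m .univ h1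
  have h2 := h P hd hm
  refine absurd hlt (not_lt.2 ?_)
  simp_rw [← ofReal_norm]
  rw [← ENNReal.ofReal_sum_of_nonneg fun _ _ => norm_nonneg _]
  exact ENNReal.ofReal_le_ofReal h2

theorem sum_norm_le_tv (m : SignedMeasure X) {P : Finset (Set X)}
    (hP : (P : Set (Set X)).PairwiseDisjoint id) : ∑ p ∈ P, ‖m p‖ ≤ tv m := by
  have h := VectorMeasure.le_variation m .univ (fun t (_ : t ∈ P) => subset_univ t) hP
  simp_rw [← ofReal_norm] at h
  rw [← ENNReal.ofReal_sum_of_nonneg fun _ _ => norm_nonneg _, ← ofReal_tv] at h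
  exact (ENNReal.ofReal_le_ofReal_iff (tv_nonneg m)).1 h

/-- Signed measures are complete for the total variation norm. -/
theorem exists_tendsto_of_cauchy_tv (u : ℕ → SignedMeasure X)
    (hu : ∀ ε > 0, ∃ K, ∀ i ≥ K, ∀ j ≥ K, tv (u i - u j) < ε) :
    ∃ m, Filter.Tendsto (fun i => tv (u i - m)) Filter.atTop (nhds 0) := by
  -- Values on sets are dominated by the total variation, so the sequence is Cauchy uniformly over
  -- all sets; the limit measure is the uniform limit.
  have hunif : ∀ ε > 0, ∃ K, ∀ i ≥ K, ∀ j ≥ K, ∀ s, ‖u i s - u j s‖ < ε := by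
    intro ε hε
    obtain ⟨K, hK⟩ := hu ε hε
    exact ⟨K, fun i hi j hj s => (norm_apply_le_tv (u i - u j) s).trans_lt (hK i hi j hj)⟩
  have hlim : ∀ s, ∃ a, Filter.Tendsto (fun i => u i s) Filter.atTop (nhds a) := by
    intro s
    refine cauchySeq_tendsto_of_complete (Metric.cauchySeq_iff.2 fun ε hε => ?_)
    obtain ⟨K, hK⟩ := hunif ε hε
    exact ⟨K, fun i hi j hj => by rw [dist_eq_norm]; exact hK i hi j hj s⟩
  choose a ha using hlim
  have haunif : ∀ ε > 0, ∃ K, ∀ i ≥ K, ∀ s, ‖u i s - a s‖ ≤ ε := by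
    intro ε hε
    obtain ⟨K, hK⟩ := hunif ε hε
    exact ⟨K, fun i hi s => le_of_tendsto (tendsto_const_nhds.sub (ha s)).norm
      (Filter.eventually_atTop.2 ⟨K, fun j hj => (hK i hi j hj s).le⟩)⟩
  let m : SignedMeasure X :=
    { measureOf' := a
      empty' := tendsto_nhds_unique (ha ∅) (by simp)
      not_measurable' := fun s hs => tendsto_nhds_unique (ha s)
        (by simp [VectorMeasure.not_measurable _ hs])
      m_iUnion' := fun f hf hd => by
        have hsum : ∀ (P : Finset ℕ), ∑ j ∈ P, a (f j) = a (⋃ j ∈ P, f j) := fun P => by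
          refine tendsto_nhds_unique (tendsto_finsetSum P fun j _ => ha (f j)) ?_
          refine (ha _).congr fun i => ?_
          exact VectorMeasure.of_biUnion_finset (fun j _ k _ hjk => hd hjk) fun j _ => hf j
        -- Finite partial sums are values on finite unions, so they converge uniformly in `P`. This
        -- permits exchanging the limit in `i` with the limit of the series.
        have hT : TendstoUniformly (fun i (P : Finset ℕ) => ∑ j ∈ P, u i (f j))
            (fun P => ∑ j ∈ P, a (f j)) Filter.atTop := by
          rw [Metric.tendstoUniformly_iff]
          intro ε hε
          obtain ⟨K, hK⟩ := haunif (ε / 2) (half_pos hε)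
          filter_upwards [Filter.eventually_ge_atTop K] with i hi P
          rw [hsum, ← VectorMeasure.of_biUnion_finset (fun j _ k _ hjk => hd hjk) fun j _ => hf j,
            dist_comm, dist_eq_norm]
          exact (hK i hi _).trans_lt (half_lt_self hε)
        exact hT.tendsto_of_eventually_tendsto
          (Filter.Eventually.of_forall fun i => (u i).m_iUnion hf hd) (ha _) }
  refine ⟨m, Metric.tendsto_atTop.2 fun ε hε => ?_⟩
  obtain ⟨K, hK⟩ := hu (ε / 2) (half_pos hε)
  refine ⟨K, fun i hi => ?_⟩
  -- Lower semicontinuity: for a fixed finite family, let `j → ∞` in the bound on `u i - u j`.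
  have h1 : tv (u i - m) ≤ ε / 2 := by
    refine tv_le_of_forall_sum_le fun P hd hP => ?_
    have h2 : Filter.Tendsto (fun j => ∑ p ∈ P, ‖(u i - u j) p‖) Filter.atTop
        (nhds (∑ p ∈ P, ‖(u i - m) p‖)) :=
      tendsto_finsetSum P fun p _ => (tendsto_const_nhds.sub (ha p)).norm
    exact le_of_tendsto h2 (Filter.eventually_atTop.2
      ⟨K, fun j hj => (sum_norm_le_tv _ hd).trans (hK i hi j hj).le⟩)
  rw [Real.dist_0_eq_abs, abs_of_nonneg (tv_nonneg _)]
  linarith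

end Completeness

/-! ### Differential operators, adjoints and pure tensors -/

section DiffOp

variable {E : Type} [NormedAddCommGroup E] [NormedSpace ℝ E]

/-- The formal adjoint `-∂_v - α I` acting on test functions. -/
def adjOp (v : E) (α : ℝ) :
    TestFunction (⊤ : Opens E) ℝ ⊤ →L[ℝ] TestFunction (⊤ : Opens E) ℝ ⊤ :=
  -TestFunction.lineDerivCLM ℝ v - α • ContinuousLinearMap.id ℝ _

theorem diffOp_succ (v : E) (α : ℝ) (N : ℕ) (T : Distribution (⊤ : Opens E) ℝ ⊤) :
    diffOp v α (N + 1) T = diffOp v α N (Distribution.lineDerivCLM v T - α • T) := by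
  rw [diffOp, pow_succ]
  rfl

theorem diffOp_apply (v : E) (α : ℝ) (N : ℕ) (T : Distribution (⊤ : Opens E) ℝ ⊤)
    (ψ : TestFunction (⊤ : Opens E) ℝ ⊤) :
    diffOp v α N T ψ = T ((adjOp v α ^ N) ψ) := by
  induction N generalizing T with
  | zero => rfl
  | succ N ih =>
    rw [diffOp_succ, ih, pow_succ', mul_apply_eq_comp]
    simp [adjOp, Distribution.lineDerivCLM_apply, map_sub, map_neg, map_smul]

theorem continuous_diffOp (v : E) (α : ℝ) (N : ℕ) : Continuous (diffOp v α N) := by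
  induction N with
  | zero => exact continuous_id
  | succ N ih =>
    have h : ⇑(diffOp v α (N + 1)) = diffOp v α N ∘
        fun T => Distribution.lineDerivCLM v T - α • T := funext (diffOp_succ v α N)
    rw [h]
    exact ih.comp ((Distribution.lineDerivCLM v).continuous.sub (continuous_const_smul α))

end DiffOp

theorem lineDeriv_fst_tensor (S T : Dist1) :
    (Distribution.lineDerivCLM ((1, 0) : ℝ × ℝ) (tensor S T) : Dist2) =
      tensor (Distribution.lineDerivCLM (1 : ℝ) S) T := by
  ext ψ
  rw [Distribution.lineDerivCLM_apply, tensor_apply, tensor_apply, ← map_neg]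
  congr 1
  ext y
  change -(S (slice (der₁ ψ) y)) = -(S (der (slice ψ y)))
  rw [der_slice]

/-- Differentiation under the pairing with `S`, from `hasDerivAt_apply_slice`. -/
theorem pairFstCLM_der₂ (S : Dist1) (ψ : Test2) :
    pairFstCLM S (der₂ ψ) = der (pairFstCLM S ψ) := by
  ext y
  rw [der_apply]
  exact (hasDerivAt_apply_slice S ψ y).deriv.symm

theorem lineDeriv_snd_tensor (S T : Dist1) :
    (Distribution.lineDerivCLM ((0, 1) : ℝ × ℝ) (tensor S T) : Dist2) =
      tensor S (Distribution.lineDerivCLM (1 : ℝ) T) := by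
  ext ψ
  rw [Distribution.lineDerivCLM_apply, tensor_apply, tensor_apply, Distribution.lineDerivCLM_apply]
  congr 2
  exact pairFstCLM_der₂ S ψ

theorem diffOp_fst_tensor (α : ℝ) (N : ℕ) (S T : Dist1) :
    diffOp ((1, 0) : ℝ × ℝ) α N (tensor S T) = tensor (ode α N S) T := by
  induction N generalizing S with
  | zero => rfl
  | succ N ih =>
    rw [diffOp_succ, ode, diffOp_succ, ← ode, ← ih, lineDeriv_fst_tensor]
    simp

theorem diffOp_snd_tensor (α : ℝ) (N : ℕ) (S T : Dist1) :
    diffOp ((0, 1) : ℝ × ℝ) α N (tensor S T) = tensor S (ode α N T) := by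
  induction N generalizing T with
  | zero => rfl
  | succ N ih =>
    rw [diffOp_succ, ode, diffOp_succ, ← ode, ← ih, lineDeriv_snd_tensor]
    simp

theorem opLL_tensor (α₁ α₂ : ℝ) (N₁ N₂ : ℕ) (S T : Dist1) :
    opLL α₁ α₂ N₁ N₂ (tensor S T) = tensor (ode α₁ N₁ S) (ode α₂ N₂ T) := by
  rw [opLL, Module.End.mul_apply, diffOp_snd_tensor, diffOp_fst_tensor]

theorem evalFst_tensor (φ : Test1) (S T : Dist1) : evalFst φ (tensor S T) = S φ • T := by
  ext ψ
  exact tensor_tensorTest S T φ ψ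

theorem evalSnd_tensor (φ : Test1) (S T : Dist1) : evalSnd φ (tensor S T) = T φ • S := by
  ext ψ
  exact (tensor_tensorTest S T ψ φ).trans (mul_comm _ _)

theorem opProjFst_tensor {N : ℕ} (p : Fin N → ℝ → ℝ) (φ : Fin N → Test1)
    (B : Module.End ℝ Dist1) (S T : Dist1) :
    opProjFst p φ B (tensor S T) = tensor (projNull p φ S) (B T) := by
  simp [opProjFst, projNull, evalFst_tensor]

theorem opProjSnd_tensor {N : ℕ} (p : Fin N → ℝ → ℝ) (φ : Fin N → Test1)
    (A : Module.End ℝ Dist1) (S T : Dist1) :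
    opProjSnd p φ A (tensor S T) = tensor (A S) (projNull p φ T) := by
  simp [opProjSnd, projNull, evalSnd_tensor]

theorem analysisOp_tensor (α₁ α₂ : ℝ) {N₁ N₂ : ℕ} (p₁ : Fin N₁ → ℝ → ℝ) (φ₁ : Fin N₁ → Test1)
    (p₂ : Fin N₂ → ℝ → ℝ) (φ₂ : Fin N₂ → Test1) (i : Fin 4) (S T : Dist1) :
    analysisOp α₁ α₂ p₁ φ₁ p₂ φ₂ i (tensor S T) =
      tensor (fstFactor α₁ p₁ φ₁ i S) (sndFactor α₂ p₂ φ₂ i T) := by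
  fin_cases i
  · exact opLL_tensor α₁ α₂ N₁ N₂ S T
  · exact opProjFst_tensor p₁ φ₁ _ S T
  · exact opProjSnd_tensor p₂ φ₂ _ S T
  · exact opProjFst_tensor p₁ φ₁ _ S T

/-! ### Exchange of the two variables -/

section Swap

/-- Exchange of the two variables of a test function. -/
def swapTest (ψ : Test2) : Test2 where
  toFun z := ψ z.swap
  contDiff' := ψ.contDiff.comp (contDiff_snd.prodMk contDiff_fst)
  hasCompactSupport' := ψ.hasCompactSupport.comp_homeomorph (Homeomorph.prodComm ℝ ℝ)
  tsupport_subset' := fun _ _ => trivial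

theorem norm_iteratedFDeriv_swap_le {f : ℝ × ℝ → ℝ} (hf : ContDiff ℝ (⊤ : ℕ∞) f) (k : ℕ)
    (z : ℝ × ℝ) :
    ‖iteratedFDeriv ℝ k (fun w => f w.swap) z‖ ≤ ‖iteratedFDeriv ℝ k f z.swap‖ := by
  let s : ℝ × ℝ →L[ℝ] ℝ × ℝ :=
    (ContinuousLinearMap.snd ℝ ℝ ℝ).prod (ContinuousLinearMap.fst ℝ ℝ ℝ)
  change ‖iteratedFDeriv ℝ k (f ∘ s) z‖ ≤ _
  rw [ContinuousLinearMap.iteratedFDeriv_comp_right (i := k) _ hf z (WithTop.coe_le_coe.2 le_top)]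
  refine le_trans (ContinuousMultilinearMap.norm_compContinuousLinearMap_le _ _) ?_
  have hs : ‖s‖ ≤ 1 := ContinuousLinearMap.opNorm_le_bound _ zero_le_one fun w => by
    simp [s, Prod.norm_def, max_comm]
  exact mul_le_of_le_one_right (norm_nonneg _)
    (Finset.prod_le_one (fun _ _ => norm_nonneg _) fun _ _ => hs)

/-- Exchange of the two variables, as a continuous linear map. -/
def swapCLM : Test2 →L[ℝ] Test2 :=
  TestFunction.mkCLM ℝ swapTest (fun _ _ => rfl) (fun _ _ => rfl) fun K _ => by
    let K' : Compacts (ℝ × ℝ) := ⟨Prod.swap '' (K : Set (ℝ × ℝ)), K.isCompact.image continuous_swap⟩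
    let A : ContDiffMapSupportedIn (ℝ × ℝ) ℝ ⊤ K →ₗ[ℝ] ContDiffMapSupportedIn (ℝ × ℝ) ℝ ⊤ K' :=
      { toFun := fun ψ => ⟨fun z => ψ z.swap,
          ψ.contDiff.comp (contDiff_snd.prodMk contDiff_fst), fun z hz =>
            ψ.zero_on_compl fun h => hz ⟨z.swap, h, z.swap_swap⟩⟩
        map_add' := fun f g => rfl
        map_smul' := fun c f => rfl }
    have hA : Continuous A := continuous_of_bound A fun k => by
      refine ⟨{k}, 1, zero_le_one, fun ψ z _ => ?_⟩
      rw [Finset.sup_singleton, one_mul]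
      exact (norm_iteratedFDeriv_swap_le ψ.contDiff k z).trans
        (ContDiffMapSupportedIn.norm_iteratedFDeriv_apply_le_seminorm_top ℝ)
    exact (TestFunction.continuous_ofSupportedIn (Ω := (⊤ : Opens (ℝ × ℝ))) (K := K')
      (fun _ _ => trivial)).comp hA

theorem der₂_swap (ψ : Test2) : der₂ (swapCLM ψ) = swapCLM (der₁ ψ) := by
  ext ⟨x, y⟩
  exact (hasDerivAt_der₂ (swapCLM ψ) x y).unique (hasDerivAt_der₁ ψ y x)

theorem der₂_pow_swap (j : ℕ) (ψ : Test2) : (der₂ ^ j) (swapCLM ψ) = swapCLM ((der₁ ^ j) ψ) := by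
  induction j generalizing ψ with
  | zero => rfl
  | succ j ih =>
    rw [pow_succ, pow_succ, mul_apply_eq_comp, mul_apply_eq_comp, der₂_swap, ih]

theorem der_pow_pairFst_swap (T : Dist1) (ψ : Test2) (j : ℕ) (x : ℝ) :
    (der ^ j) (pairFstCLM T (swapCLM ψ)) x = T (slice (swapCLM ((der₁ ^ j) ψ)) x) := by
  rw [← iteratedDeriv_eq_der_pow, ← der₂_pow_swap]
  exact congrFun (iteratedDeriv_apply_slice T (swapCLM ψ) j) x

end Swap

/-! ### Fubini for tensor products and continuity of the operators -/

section Fubini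

theorem der_pow_eq_zero (φ : Test1) {K : Set ℝ} (hK : IsClosed K) (hφ : ∀ x ∉ K, φ x = 0)
    (k : ℕ) : ∀ x ∉ K, (der ^ k) φ x = 0 := by
  induction k with
  | zero => exact hφ
  | succ k ih =>
    intro x hx
    rw [pow_succ', mul_apply_eq_comp, der_apply]
    have h : (der ^ k) φ =ᶠ[nhds x] fun _ => 0 :=
      Filter.eventually_of_mem (hK.isOpen_compl.mem_nhds hx) fun w hw => ih w hw
    rw [h.deriv_eq]
    simp

/-- A linear form dominated by the norm of a linear map factors through a continuous linear
form. -/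
theorem exists_clm_comp_eq {V X : Type*} [AddCommGroup V] [Module ℝ V] [NormedAddCommGroup X]
    [NormedSpace ℝ X] (J : V →ₗ[ℝ] X) (f : V →ₗ[ℝ] ℝ) (C : ℝ) (h : ∀ v, |f v| ≤ C * ‖J v‖) :
    ∃ F : X →L[ℝ] ℝ, ∀ v, F (J v) = f v := by
  -- The bound makes `f` vanish on `ker J`, so `f = g ∘ J` with `g` linear. Only the restriction of
  -- `g` to `range J` is known to be bounded; Hahn–Banach extends that restriction.
  have hf : f ∈ LinearMap.range J.dualMap := by
    rw [LinearMap.range_dualMap_eq_dualAnnihilator_ker, Submodule.mem_dualAnnihilator]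
    intro v hv
    have := h v
    rw [LinearMap.mem_ker.1 hv, norm_zero, mul_zero] at this
    exact abs_nonpos_iff.1 this
  obtain ⟨g, rfl⟩ := hf
  obtain ⟨F, hF, -⟩ := _root_.exists_extension_norm_eq (LinearMap.range J)
    ((g.domRestrict (LinearMap.range J)).mkContinuous C (by rintro ⟨-, v, rfl⟩; exact h v))
  exact ⟨F, fun v => hF ⟨J v, v, rfl⟩⟩

/-- On the projection `K` of the support of `ψ`, the distribution `S` has finite order, hence is a
continuous functional `F` of the jet `J` in a Banach space. There `F` commutes with the Bochner
integral over `y`, which exchanges the order of the two pairings. -/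
theorem tensor_ofFun_apply (S : Dist1) {p : ℝ → ℝ} (hp : LocallyIntegrable p volume)
    (ψ : Test2) :
    tensor S (ofFun p) ψ = S (pairFstCLM (ofFun p) (swapCLM ψ)) := by
  let K : Compacts ℝ := ⟨Prod.fst '' tsupport ψ, ψ.hasCompactSupport.image continuous_fst⟩
  have hψ : ∀ x ∉ K, ∀ y, ψ (x, y) = 0 := fun x hx y => by
    by_contra h
    exact hx ⟨(x, y), subset_tsupport _ h, rfl⟩
  obtain ⟨n, C, hC0, hC⟩ := dist_bound S K
  let V : Submodule ℝ Test1 :=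
    { carrier := {φ | ∀ x ∉ K, φ x = 0}
      add_mem' := fun {f g} hf hg x hx => by simp [hf x hx, hg x hx]
      zero_mem' := fun _ _ => rfl
      smul_mem' := fun c f hf x hx => by simp [hf x hx] }
  -- The `n`-jet on `K`: its norm dominates `S` on `V` by `dist_bound`.
  let J : V →ₗ[ℝ] (Fin (n + 1) → C(K, ℝ)) :=
    { toFun := fun φ j => ⟨fun x => (der ^ (j : ℕ)) φ x, by fun_prop⟩
      map_add' := fun f g => by ext j x; simp
      map_smul' := fun c f => by ext j x; simp }
  obtain ⟨F, hF⟩ := exists_clm_comp_eq J ((S : Test1 →ₗ[ℝ] ℝ) ∘ₗ V.subtype) C fun φ => by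
    refine hC φ φ.2 _ (norm_nonneg _) fun j hj x => ?_
    by_cases hx : x ∈ K
    · exact ((J φ ⟨j, by omega⟩).norm_coe_le_norm ⟨x, hx⟩).trans (norm_le_pi_norm (J φ) _)
    · rw [der_pow_eq_zero _ K.isCompact.isClosed φ.2 j x hx, abs_zero]
      exact norm_nonneg _
  let s : ℝ → V := fun y => ⟨slice ψ y, fun x hx => hψ x hx y⟩
  have hs : Continuous fun y => J (s y) := by
    refine continuous_pi fun j => ?_
    -- Joint continuity of the derivative, once curried, is continuity in `y` for the uniform norm
    -- on `K`.
    let G : C(ℝ × K, ℝ) := ⟨fun z => ((der₁ ^ (j : ℕ)) ψ) (z.2, z.1), by fun_prop⟩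
    have : (fun y => J (s y) j) = G.curry := by
      ext y x
      change (der ^ (j : ℕ)) (slice ψ y) x = _
      rw [der_pow_slice]
      rfl
    rw [this]
    exact G.curry.continuous
  have hsc : HasCompactSupport fun y => J (s y) := by
    refine HasCompactSupport.intro (ψ.hasCompactSupport.image continuous_snd) fun y hy => ?_
    have : s y = 0 := by
      ext x
      by_contra h
      exact hy ⟨(x, y), subset_tsupport _ h, rfl⟩
    rw [this, map_zero]
  have hi : Integrable (fun y => p y • J (s y)) :=
    hp.integrable_smul_right_of_hasCompactSupport hs hsc
  have h1 : F (∫ y, p y • J (s y)) = tensor S (ofFun p) ψ := by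
    rw [← F.integral_comp_comm hi, tensor_apply, ofFun_apply hp]
    refine integral_congr_ae (Filter.Eventually.of_forall fun y => ?_)
    simp only [map_smul, hF]
    exact mul_comm _ _
  let q : V := ⟨pairFstCLM (ofFun p) (swapCLM ψ), fun x hx =>
    apply_slice_eq_zero _ _ fun y => hψ x hx y⟩
  -- Evaluation at each pair `(j, x)` is continuous and reduces this to differentiating `q` under
  -- the integral.
  have h2 : ∫ y, p y • J (s y) = J q := by
    ext j x
    let ev : (Fin (n + 1) → C(K, ℝ)) →L[ℝ] ℝ :=
      (ContinuousMap.evalCLM ℝ x) ∘L (ContinuousLinearMap.proj j)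
    change ev (∫ y, p y • J (s y)) = (der ^ (j : ℕ)) (pairFstCLM (ofFun p) (swapCLM ψ)) x
    rw [← ev.integral_comp_comm hi, der_pow_pairFst_swap, ofFun_apply hp]
    refine integral_congr_ae (Filter.Eventually.of_forall fun y => ?_)
    change p y * (der ^ (j : ℕ)) (slice ψ y) x = _
    rw [der_pow_slice, mul_comm]
    rfl
  rw [← h1, h2, hF]
  rfl

/-- With the pairings exchanged, `S ↦ S ⊗ p` is the transpose of a fixed continuous map of test
functions. This is what `continuous_opProjSnd` needs. -/
theorem continuous_tensor_ofFun {p : ℝ → ℝ} (hp : LocallyIntegrable p volume) :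
    Continuous fun S : Dist1 => tensor S (ofFun p) := by
  have : (fun S : Dist1 => tensor S (ofFun p)) =
      ((pairFstCLM (ofFun p)).comp swapCLM).precompCompactConvergenceCLM ℝ := by
    ext S ψ
    exact tensor_ofFun_apply S hp ψ
  rw [this]
  exact ContinuousLinearMap.continuous _

theorem continuous_tensor_right (S : Dist1) : Continuous fun T : Dist1 => tensor S T :=
  ((pairFstCLM S).precompCompactConvergenceCLM ℝ).continuous

theorem continuous_projNull {N : ℕ} (p : Fin N → ℝ → ℝ) (φ : Fin N → Test1) :
    Continuous (projNull p φ) := by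
  change Continuous fun f : Dist1 => ∑ n, f (φ n) • (ofFun (p n) : Dist1)
  refine continuous_finsetSum _ fun n _ => ?_
  have h : Continuous fun f : Dist1 => f (φ n) := continuous_eval_const (φ n)
  fun_prop

theorem continuous_opProjFst {N : ℕ} (p : Fin N → ℝ → ℝ) (φ : Fin N → Test1)
    {B : Module.End ℝ Dist1} (hB : Continuous B) : Continuous (opProjFst p φ B) := by
  have : ⇑(opProjFst p φ B) = fun f => ∑ n, tensor (ofFun (p n)) (B (evalFst (φ n) f)) := by
    ext1 f; simp [opProjFst]
  rw [this]
  exact continuous_finsetSum _ fun n _ =>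
    (continuous_tensor_right _).comp (hB.comp (evalFst (φ n)).continuous)

theorem continuous_opProjSnd {N : ℕ} {p : Fin N → ℝ → ℝ} (hp : ∀ n, Continuous (p n))
    (φ : Fin N → Test1) {A : Module.End ℝ Dist1} (hA : Continuous A) :
    Continuous (opProjSnd p φ A) := by
  have : ⇑(opProjSnd p φ A) = fun f => ∑ n, tensor (A (evalSnd (φ n) f)) (ofFun (p n)) := by
    ext1 f; simp [opProjSnd]
  rw [this]
  exact continuous_finsetSum _ fun n _ =>
    (continuous_tensor_ofFun (hp n).locallyIntegrable).comp (hA.comp (evalSnd (φ n)).continuous)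

theorem tensor_ofFun_ofFun {f g : ℝ → ℝ} (hf : LocallyIntegrable f volume)
    (hg : LocallyIntegrable g volume) :
    LocallyIntegrable (fun z : ℝ × ℝ => f z.1 * g z.2) volume ∧
      tensor (ofFun f) (ofFun g) = ofFun fun z : ℝ × ℝ => f z.1 * g z.2 := by
  have hfg : LocallyIntegrable (fun z : ℝ × ℝ => f z.1 * g z.2) volume := by
    rw [locallyIntegrable_iff]
    intro B hB
    have h1 := hf.integrableOn_isCompact (hB.image continuous_fst)
    have h2 := hg.integrableOn_isCompact (hB.image continuous_snd)
    have h3 : IntegrableOn (fun z : ℝ × ℝ => f z.1 * g z.2)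
        ((Prod.fst '' B) ×ˢ (Prod.snd '' B)) volume := by
      rw [IntegrableOn, Measure.volume_eq_prod, ← Measure.prod_restrict]
      exact Integrable.mul_prod h1 h2
    exact h3.mono_set fun z hz => ⟨⟨z, hz, rfl⟩, ⟨z, hz, rfl⟩⟩
  refine ⟨hfg, ?_⟩
  ext ψ
  have hi : Integrable (fun z : ℝ × ℝ => ψ z * (f z.1 * g z.2)) :=
    hfg.integrable_smul_left_of_hasCompactSupport ψ.continuous ψ.hasCompactSupport
  rw [tensor_apply, ofFun_apply hg, ofFun_apply hfg, Measure.volume_eq_prod, integral_prod_symm _ hi]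
  refine integral_congr_ae (Filter.Eventually.of_forall fun y => ?_)
  simp only [pairFstCLM_apply, ofFun_apply hf, slice_apply]
  rw [← integral_mul_const]
  simp only [mul_assoc]

end Fubini

/-! ### Linearity of the embedding of functions -/

section OfFun

variable {E : Type} [NormedAddCommGroup E] [NormedSpace ℝ E] [MeasureSpace E] [BorelSpace E]

theorem integrable_test_mul {f : E → ℝ} (hf : LocallyIntegrable f volume)
    (ψ : TestFunction (⊤ : Opens E) ℝ ⊤) : Integrable (fun x => ψ x * f x) :=
  hf.integrable_smul_left_of_hasCompactSupport ψ.continuous ψ.hasCompactSupport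

theorem ofFun_add {f g : E → ℝ} (hf : LocallyIntegrable f volume)
    (hg : LocallyIntegrable g volume) :
    (ofFun (f + g) : Distribution (⊤ : Opens E) ℝ ⊤) = ofFun f + ofFun g := by
  ext ψ
  change ofFun (f + g) ψ = ofFun f ψ + ofFun g ψ
  rw [ofFun_apply (hf.add hg), ofFun_apply hf, ofFun_apply hg,
    ← integral_add (integrable_test_mul hf ψ) (integrable_test_mul hg ψ)]
  simp only [Pi.add_apply, mul_add]

theorem ofFun_smul (c : ℝ) {f : E → ℝ} (hf : LocallyIntegrable f volume) :
    (ofFun (c • f) : Distribution (⊤ : Opens E) ℝ ⊤) = c • ofFun f := by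
  ext ψ
  change ofFun (c • f) ψ = c * ofFun f ψ
  rw [ofFun_apply (hf.smul c), ofFun_apply hf, ← integral_const_mul]
  simp only [Pi.smul_apply, smul_eq_mul, mul_left_comm]

theorem ofFun_zero : (ofFun (0 : E → ℝ) : Distribution (⊤ : Opens E) ℝ ⊤) = 0 := by
  ext ψ
  rw [ofFun_apply (f := (0 : E → ℝ)) locallyIntegrable_zero]
  simp

theorem ofFun_sum_smul {ι : Type} (s : Finset ι) (c : ι → ℝ) {f : ι → E → ℝ}
    (hf : ∀ i, LocallyIntegrable (f i) volume) :
    LocallyIntegrable (∑ i ∈ s, c i • f i) volume ∧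
    (ofFun (∑ i ∈ s, c i • f i) : Distribution (⊤ : Opens E) ℝ ⊤) = ∑ i ∈ s, c i • ofFun (f i) := by
  classical
  induction s using Finset.induction_on with
  | empty => exact ⟨locallyIntegrable_zero, ofFun_zero⟩
  | insert i s hi ih =>
    rw [Finset.sum_insert hi, Finset.sum_insert hi, ofFun_add ((hf i).smul _) ih.1,
      ofFun_smul _ (hf i), ih.2]
    exact ⟨((hf i).smul _).add ih.1, rfl⟩

end OfFun

/-! ### The Green's function as a fundamental solution -/

section Green

/-- The adjoint of `D - α I` on test functions on the line. -/
theorem adjOp_apply (α : ℝ) (ψ : Test1) (t : ℝ) :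
    adjOp (1 : ℝ) α ψ t = -deriv ψ t - α * ψ t := by
  rw [← der_apply]
  rfl

/-- Integration by parts in the form `(-ψ' - α ψ) u = ψ v - (ψ u)'` with `v = (D - α) u`. Compact
support leaves only the boundary term at `x` on a half line, and none on the whole line. -/
theorem integral_mul_adjOp {α : ℝ} {u v : ℝ → ℝ} (hu : ContDiff ℝ 1 u) (hv : Continuous v)
    (huv : ∀ t, HasDerivAt u (v t + α * u t) t) (ψ : Test1) :
    (∀ x, ∫ t in Ioi x, adjOp (1 : ℝ) α ψ t * u t = (∫ t in Ioi x, ψ t * v t) + ψ x * u x) ∧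
    ∫ t, adjOp (1 : ℝ) α ψ t * u t = ∫ t, ψ t * v t := by
  have hψ : ContDiff ℝ 1 ψ := ψ.contDiff.of_le (by exact_mod_cast le_top)
  have hF : ContDiff ℝ 1 (fun t => ψ t * u t) := hψ.mul hu
  have hFc : HasCompactSupport (fun t => ψ t * u t) := ψ.hasCompactSupport.mul_right
  have hd : ∀ t, HasDerivAt (fun t => ψ t * u t) (deriv ψ t * u t + ψ t * (v t + α * u t)) t :=
    fun t => ((hψ.differentiable one_ne_zero t).hasDerivAt).mul (huv t)
  have e : ∀ t, adjOp (1 : ℝ) α ψ t * u t = ψ t * v t - deriv (fun t => ψ t * u t) t := by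
    intro t
    rw [(hd t).deriv, adjOp_apply]
    ring
  have i1 : Integrable fun t => ψ t * v t := integrable_test_mul hv.locallyIntegrable ψ
  have i2 : Integrable (deriv fun t => ψ t * u t) :=
    (hF.continuous_deriv le_rfl).integrable_of_hasCompactSupport hFc.deriv
  have i3 : Integrable fun t => ψ t * u t := integrable_test_mul hu.continuous.locallyIntegrable ψ
  refine ⟨fun x => ?_, ?_⟩
  · simp_rw [e]
    rw [integral_sub i1.integrableOn i2.integrableOn, hFc.integral_Ioi_deriv_eq hF x]
    ring
  · simp_rw [e]
    rw [integral_sub i1 i2, integral_eq_zero_of_hasDerivAt_of_integrable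
      (fun t => (hF.differentiable one_ne_zero t).hasDerivAt) i2 i3, sub_zero]

/-- The function `t ↦ t ^ k e ^ (α t) / k!`. -/
def expPoly (α : ℝ) (k : ℕ) (t : ℝ) : ℝ := t ^ k * Real.exp (α * t) / (k.factorial : ℝ)

theorem contDiff_expPoly (α : ℝ) (k : ℕ) : ContDiff ℝ 1 (expPoly α k) := by
  unfold expPoly
  fun_prop

theorem hasDerivAt_expPoly_zero (α t : ℝ) :
    HasDerivAt (expPoly α 0) (0 + α * expPoly α 0 t) t := by
  have h : HasDerivAt (fun t => Real.exp (α * t)) (Real.exp (α * t) * (α * 1)) t :=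
    ((hasDerivAt_id t).const_mul α).exp
  have e : expPoly α 0 = fun t => Real.exp (α * t) := by ext t; simp [expPoly]
  rw [e]
  exact h.congr_deriv (by ring)

theorem hasDerivAt_expPoly_succ (α : ℝ) (k : ℕ) (t : ℝ) :
    HasDerivAt (expPoly α (k + 1)) (expPoly α k t + α * expPoly α (k + 1) t) t := by
  have h : HasDerivAt (fun t => Real.exp (α * t)) (Real.exp (α * t) * (α * 1)) t :=
    ((hasDerivAt_id t).const_mul α).exp
  have h2 := ((hasDerivAt_pow (k + 1) t).mul h).div_const ((k + 1).factorial : ℝ)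
  refine h2.congr_deriv ?_
  have hk : (k.factorial : ℝ) ≠ 0 := by positivity
  simp only [expPoly, Nat.factorial_succ, Nat.cast_mul, Nat.add_sub_cancel, Nat.cast_add,
    Nat.cast_one]
  field_simp

/-- `D - α` lowers the index of `expPoly` by one and kills index zero, so `k + 1` integrations by
parts exhaust it. The boundary value `expPoly α j 0` is `1` for `j = 0` and `0` otherwise. The half
line gives the fundamental solution, the whole line an element of the null space. -/
theorem integral_adjOp_pow_expPoly (α : ℝ) (k : ℕ) (x : ℝ) (ψ : Test1) :
    ∫ t in Ioi x, (adjOp (1 : ℝ) α ^ (k + 1)) ψ t * expPoly α k (t - x) = ψ x ∧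
    ∫ t, (adjOp (1 : ℝ) α ^ (k + 1)) ψ t * expPoly α k (t - x) = 0 := by
  induction k with
  | zero =>
    have h := integral_mul_adjOp (α := α) (u := fun t => expPoly α 0 (t - x)) (v := fun _ => 0)
      ((contDiff_expPoly α 0).comp (by fun_prop)) continuous_const
      (fun t => (hasDerivAt_expPoly_zero α (t - x)).comp_sub_const t x) ψ
    simpa [expPoly] using And.intro (h.1 x) h.2
  | succ k ih =>
    have h := integral_mul_adjOp (α := α) (u := fun t => expPoly α (k + 1) (t - x))
      (v := fun t => expPoly α k (t - x)) ((contDiff_expPoly α (k + 1)).comp (by fun_prop))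
      ((contDiff_expPoly α k).continuous.comp (by fun_prop))
      (fun t => (hasDerivAt_expPoly_succ α k (t - x)).comp_sub_const t x)
      ((adjOp (1 : ℝ) α ^ (k + 1)) ψ)
    rw [pow_succ', mul_apply_eq_comp, h.1 x, h.2, ih.1, ih.2]
    simp [expPoly]

theorem greenFun_of_nonneg {α : ℝ} {N : ℕ} {t : ℝ} (ht : 0 ≤ t) :
    greenFun α N t = expPoly α (N - 1) t := if_pos ht

theorem greenFun_of_neg {α : ℝ} {N : ℕ} {t : ℝ} (ht : t < 0) : greenFun α N t = 0 :=
  if_neg (not_le.2 ht)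

theorem measurable_greenFun (α : ℝ) (N : ℕ) : Measurable (greenFun α N) :=
  Measurable.ite measurableSet_Ici (by fun_prop) measurable_const

theorem abs_greenFun_le (α : ℝ) (N : ℕ) (t : ℝ) : |greenFun α N t| ≤ |expPoly α (N - 1) t| := by
  rcases le_or_gt 0 t with h | h
  · rw [greenFun_of_nonneg h]
  · rw [greenFun_of_neg h, abs_zero]; exact abs_nonneg _

theorem exists_bound_greenFun (α : ℝ) (N : ℕ) (R : ℝ) :
    ∃ M, 0 ≤ M ∧ ∀ t, |t| ≤ R → |greenFun α N t| ≤ M := by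
  obtain ⟨M, hM⟩ := (isCompact_Icc (a := -R) (b := R)).exists_bound_of_continuousOn
    (contDiff_expPoly α (N - 1)).continuous.continuousOn
  exact ⟨max M 0, le_max_right _ _, fun t ht =>
    (abs_greenFun_le α N t).trans ((hM t (abs_le.1 ht)).trans (le_max_left _ _))⟩

theorem locallyIntegrable_greenFun (α : ℝ) (N : ℕ) (x : ℝ) :
    LocallyIntegrable (fun t => greenFun α N (t - x)) volume := by
  have h : LocallyIntegrable (fun t => expPoly α (N - 1) (t - x)) volume :=
    ((contDiff_expPoly α (N - 1)).continuous.comp (by fun_prop)).locallyIntegrable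
  exact h.mono ((measurable_greenFun α N).comp (by fun_prop)).aestronglyMeasurable
    (Filter.Eventually.of_forall fun t => abs_greenFun_le α N (t - x))

theorem ode_ofFun_greenFun (α : ℝ) {N : ℕ} (hN : 1 ≤ N) (x : ℝ) :
    ode α N (ofFun fun t => greenFun α N (t - x)) = Distribution.delta x := by
  obtain ⟨k, rfl⟩ : ∃ k, N = k + 1 := ⟨N - 1, by omega⟩
  ext ψ
  rw [ode, diffOp_apply, ofFun_apply (locallyIntegrable_greenFun α (k + 1) x),
    Distribution.delta_apply, ← (integral_adjOp_pow_expPoly α k x ψ).1, ← integral_Ici_eq_integral_Ioi,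
    ← integral_indicator measurableSet_Ici]
  refine integral_congr_ae (Filter.Eventually.of_forall fun t => ?_)
  by_cases ht : x ≤ t
  · simp [indicator, ht, greenFun_of_nonneg (sub_nonneg.2 ht)]
  · simp [indicator, ht, greenFun_of_neg (sub_neg.2 (not_le.1 ht))]

theorem ofFun_expPoly_mem_nullSpace (α : ℝ) {N : ℕ} (hN : 1 ≤ N) (x : ℝ) :
    ofFun (fun t => expPoly α (N - 1) (t - x)) ∈ nullSpace α N := by
  obtain ⟨k, rfl⟩ : ∃ k, N = k + 1 := ⟨N - 1, by omega⟩
  have h : Continuous fun t => expPoly α k (t - x) :=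
    (contDiff_expPoly α k).continuous.comp (by fun_prop)
  rw [nullSpace, LinearMap.mem_ker]
  ext ψ
  rw [ode, diffOp_apply, Nat.add_sub_cancel, ofFun_apply h.locallyIntegrable]
  exact (integral_adjOp_pow_expPoly α k x ψ).2

end Green

/-! ### Admissible systems and boundedness of the kernel -/

section Admissible

variable {α : ℝ} {N : ℕ} {p : Fin N → ℝ → ℝ} {φ : Fin N → Test1}

namespace IsAdmissible

variable (h : IsAdmissible α N p φ)
include h

theorem locallyIntegrable (n : Fin N) : LocallyIntegrable (p n) volume :=
  (h.continuous n).locallyIntegrable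

theorem ofFun_apply_test (n m : Fin N) : ofFun (p n) (φ m) = if n = m then 1 else 0 := by
  rw [ofFun_apply (h.locallyIntegrable n), ← h.biorthogonal n m]
  simp only [mul_comm]

theorem mem_nullSpace (n : Fin N) : ofFun (p n) ∈ nullSpace α N := by
  rw [← h.span_eq]
  exact Submodule.subset_span ⟨n, rfl⟩

theorem ode_ofFun (n : Fin N) : ode α N (ofFun (p n)) = 0 := h.mem_nullSpace n

theorem projNull_ofFun (n : Fin N) : projNull p φ (ofFun (p n)) = ofFun (p n) := by
  simp [projNull, h.ofFun_apply_test]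

theorem projNull_eq_self {T : Dist1} (hT : T ∈ nullSpace α N) : projNull p φ T = T := by
  rw [← h.span_eq] at hT
  induction hT using Submodule.span_induction with
  | mem x hx => obtain ⟨n, rfl⟩ := hx; exact h.projNull_ofFun n
  | zero => exact map_zero _
  | add x y _ _ hx hy => rw [map_add, hx, hy]
  | smul c x _ hx => rw [map_smul, hx]

theorem projNull_mem (T : Dist1) : projNull p φ T ∈ nullSpace α N := by
  change ∑ n, T (φ n) • (ofFun (p n) : Dist1) ∈ _
  exact Submodule.sum_mem _ fun n _ => Submodule.smul_mem _ _ (h.mem_nullSpace n)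

theorem ode_projNull (T : Dist1) : ode α N (projNull p φ T) = 0 := h.projNull_mem T

/-- The projector reproduces the null space, and continuity of both sides makes the identity hold at
every point. The pointwise form is what cancels the kernel far out in `isLocBddKernel`. -/
theorem eq_sum_of_continuous {f : ℝ → ℝ} (hf : Continuous f) (hn : ofFun f ∈ nullSpace α N) :
    f = ∑ n, (ofFun f (φ n)) • p n := by
  refine eq_of_ofFun_eq hf ?_ ?_
  · have : (∑ n, (ofFun f (φ n)) • p n) = fun t => ∑ n, (ofFun f (φ n)) * p n t := by
      ext t; simp
    rw [this]
    exact continuous_finsetSum _ fun n _ => continuous_const.mul (h.continuous n)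
  · rw [(ofFun_sum_smul _ _ h.locallyIntegrable).2]
    exact (h.projNull_eq_self hn).symm

end IsAdmissible

/-- Translation invariance turns the coefficients of the kernel into pairings with the translated
Green's function, so that the kernel is `I - proj` applied to the latter. -/
theorem integral_greenFun_shift (φ : Test1) (x : ℝ) :
    ∫ s, greenFun α N s * φ (s + x) = ofFun (fun t => greenFun α N (t - x)) φ := by
  rw [ofFun_apply (locallyIntegrable_greenFun α N x),
    ← integral_sub_right_eq_self (fun s => greenFun α N s * φ (s + x)) x]
  simp only [sub_add_cancel, mul_comm]

theorem kernel_eq (t x : ℝ) : kernel α p φ t x =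
    greenFun α N (t - x) - ∑ n, ofFun (fun t => greenFun α N (t - x)) (φ n) * p n t := by
  simp only [kernel, integral_greenFun_shift]

namespace IsAdmissible

variable (h : IsAdmissible α N p φ)
include h

theorem ofFun_kernel (x : ℝ) : ofFun (fun t => kernel α p φ t x) =
    ofFun (fun t => greenFun α N (t - x)) - projNull p φ (ofFun fun t => greenFun α N (t - x)) := by
  have e : (fun t => kernel α p φ t x) = (fun t => greenFun α N (t - x)) +
      ((-1 : ℝ) • ∑ n, ofFun (fun t => greenFun α N (t - x)) (φ n) • p n) := by
    ext t
    simp [kernel_eq, sub_eq_add_neg]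
  have hs := ofFun_sum_smul Finset.univ
    (fun n => ofFun (fun t => greenFun α N (t - x)) (φ n)) h.locallyIntegrable
  rw [e, ofFun_add (locallyIntegrable_greenFun α N x) (hs.1.smul _), ofFun_smul _ hs.1, hs.2,
    neg_one_smul, ← sub_eq_add_neg]
  rfl

theorem ode_ofFun_kernel (hN : 1 ≤ N) (x : ℝ) :
    ode α N (ofFun fun t => kernel α p φ t x) = Distribution.delta x := by
  rw [h.ofFun_kernel, map_sub, h.ode_projNull, ode_ofFun_greenFun α hN, sub_zero]

theorem projNull_ofFun_kernel (x : ℝ) :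
    projNull p φ (ofFun fun t => kernel α p φ t x) = 0 := by
  rw [h.ofFun_kernel, map_sub, h.projNull_eq_self (h.projNull_mem _), sub_self]

/-- Independence of the `p n` extracts the individual coefficients from a vanishing projection. -/
theorem ofFun_kernel_apply_test (x : ℝ) (n : Fin N) :
    ofFun (fun t => kernel α p φ t x) (φ n) = 0 := by
  have h1 := h.projNull_ofFun_kernel x
  exact Fintype.linearIndependent_iff.1 h.linearIndependent _ h1 n

theorem measurable_kernel : Measurable (Function.uncurry (kernel α p φ)) := by
  refine Measurable.sub ((measurable_greenFun α N).comp (measurable_fst.sub measurable_snd)) ?_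
  refine Finset.measurable_fun_sum _ fun n _ => Measurable.mul ?_ ((h.continuous n).measurable.comp measurable_fst)
  have hm : StronglyMeasurable (Function.uncurry fun x s : ℝ => greenFun α N s * φ n (s + x)) :=
    (((measurable_greenFun α N).comp measurable_snd).mul
      ((φ n).continuous.measurable.comp (measurable_snd.add measurable_fst))).stronglyMeasurable
  exact hm.integral_prod_right.measurable.comp measurable_snd

/-- Let `R` bound `B` and the supports of the `φ n`. If `x > R`, the translated Green's function
vanishes at all these points; if `x < -R`, it agrees there with an element of the null space, which
the correction terms reproduce. Either way the kernel is zero, and `|x| ≤ R` leaves only bounded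
arguments. -/
theorem isLocBddKernel (hN : 1 ≤ N) : IsLocBddKernel (kernel α p φ) := by
  refine ⟨h.measurable_kernel, fun B hB => ?_⟩
  have hcomp : IsCompact (B ∪ ⋃ n, tsupport (φ n)) :=
    hB.union (isCompact_iUnion fun n => (φ n).hasCompactSupport)
  obtain ⟨R, hR⟩ := hcomp.isBounded.exists_norm_le
  have hRB : ∀ t ∈ B, |t| ≤ R := fun t ht => hR t (Or.inl ht)
  have hRφ : ∀ n t, φ n t ≠ 0 → |t| ≤ R := fun n t ht =>
    hR t (Or.inr (mem_iUnion.2 ⟨n, subset_tsupport _ ht⟩))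
  -- `2 * R` bounds `|t - x|` once `|t|` and `|x|` are at most `R`.
  obtain ⟨M, hM0, hM⟩ := exists_bound_greenFun α N (2 * R)
  choose P hP using fun n => hB.exists_bound_of_continuousOn (h.continuous n).continuousOn
  have hfar : ∀ t ∈ B, ∀ x, R < |x| → kernel α p φ t x = 0 := by
    intro t ht x hx
    rw [kernel_eq]
    rcases lt_abs.1 hx with hx | hx
    · have h0 : ∀ s, |s| ≤ R → greenFun α N (s - x) = 0 := fun s hs =>
        greenFun_of_neg (by linarith [(abs_le.1 hs).2])
      have hc : ∀ n, ofFun (fun t => greenFun α N (t - x)) (φ n) = 0 := by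
        intro n
        rw [ofFun_apply (locallyIntegrable_greenFun α N x)]
        refine integral_eq_zero_of_ae (Filter.Eventually.of_forall fun s => ?_)
        by_cases hs : φ n s = 0
        · simp [hs]
        · simp [h0 s (hRφ n s hs)]
      simp [hc, h0 t (hRB t ht)]
    · have h0 : ∀ s, |s| ≤ R → greenFun α N (s - x) = expPoly α (N - 1) (s - x) := fun s hs =>
        greenFun_of_nonneg (by linarith [(abs_le.1 hs).1])
      have hq : Continuous fun s => expPoly α (N - 1) (s - x) :=
        (contDiff_expPoly α (N - 1)).continuous.comp (by fun_prop)
      have hc : ∀ n, ofFun (fun t => greenFun α N (t - x)) (φ n) =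
          ofFun (fun s => expPoly α (N - 1) (s - x)) (φ n) := by
        intro n
        rw [ofFun_apply (locallyIntegrable_greenFun α N x), ofFun_apply hq.locallyIntegrable]
        refine integral_congr_ae (Filter.Eventually.of_forall fun s => ?_)
        by_cases hs : φ n s = 0
        · simp [hs]
        · simp [h0 s (hRφ n s hs)]
      -- The coefficients see only the supports of the `φ n`, so they are those of `expPoly`, and
      -- its expansion cancels the value at `t`.
      have e := congrFun (h.eq_sum_of_continuous hq (ofFun_expPoly_mem_nullSpace α hN x)) t
      simp only [hc, h0 t (hRB t ht)]
      rw [e]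
      simp
  have hnear : ∀ x, |x| ≤ R → ∀ n,
      |ofFun (fun t => greenFun α N (t - x)) (φ n)| ≤ ∫ t, |φ n t| * M := by
    intro x hx n
    rw [ofFun_apply (locallyIntegrable_greenFun α N x), ← Real.norm_eq_abs]
    refine norm_integral_le_of_norm_le
      (((φ n).continuous.integrable_of_hasCompactSupport (φ n).hasCompactSupport).norm.mul_const M)
      (Filter.Eventually.of_forall fun s => ?_)
    rw [norm_mul]
    by_cases hs : φ n s = 0
    · simp [hs]
    · refine mul_le_mul_of_nonneg_left (hM _ ?_) (norm_nonneg _)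
      exact (abs_sub s x).trans (by linarith [hRφ n s hs])
  -- The maximum with `0` serves the far region without a sign check on `P n`, which is
  -- unconstrained when `B` is empty.
  refine ⟨max 0 (M + ∑ n, (∫ t, |φ n t| * M) * P n), fun t ht x => ?_⟩
  rcases lt_or_ge R |x| with hx | hx
  · rw [hfar t ht x hx, abs_zero]
    exact le_max_left _ _
  · refine le_trans ?_ (le_max_right _ _)
    rw [kernel_eq]
    refine (abs_sub _ _).trans (add_le_add (hM _ ?_) ((Finset.abs_sum_le_sum_abs _ _).trans
      (Finset.sum_le_sum fun n _ => ?_)))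
    · exact (abs_sub t x).trans (by linarith [hRB t ht])
    · rw [abs_mul]
      exact mul_le_mul (hnear x hx n) (hP n t ht) (abs_nonneg _)
        (integral_nonneg fun s => by positivity)

end IsAdmissible

end Admissible

theorem forall_fin_four {P : Fin 4 → Prop} (h0 : P 0) (h1 : P 1) (h2 : P 2) (h3 : P 3) :
    ∀ i, P i := by
  intro i
  fin_cases i <;> assumption

/-! ### Product kernels and potentials of measures -/

section Potentials

theorem IsLocBddKernel.prod {k₁ k₂ : ℝ → ℝ → ℝ} (h₁ : IsLocBddKernel k₁)
    (h₂ : IsLocBddKernel k₂) :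
    IsLocBddKernel fun t x : ℝ × ℝ => k₁ t.1 x.1 * k₂ t.2 x.2 := by
  refine ⟨?_, fun B hB => ?_⟩
  · have m₁ : Measurable fun z : (ℝ × ℝ) × (ℝ × ℝ) => k₁ z.1.1 z.2.1 :=
      h₁.measurable.comp ((measurable_fst.comp measurable_fst).prodMk
        (measurable_fst.comp measurable_snd))
    have m₂ : Measurable fun z : (ℝ × ℝ) × (ℝ × ℝ) => k₂ z.1.2 z.2.2 :=
      h₂.measurable.comp ((measurable_snd.comp measurable_fst).prodMk
        (measurable_snd.comp measurable_snd))
    exact m₁.mul m₂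
  · obtain ⟨C₁, hC₁⟩ := h₁.bound _ (hB.image continuous_fst)
    obtain ⟨C₂, hC₂⟩ := h₂.bound _ (hB.image continuous_snd)
    refine ⟨C₁ * C₂, fun t ht x => ?_⟩
    rw [abs_mul]
    have a₁ := hC₁ t.1 ⟨t, ht, rfl⟩ x.1
    exact mul_le_mul a₁ (hC₂ t.2 ⟨t, ht, rfl⟩ x.2) (abs_nonneg _) ((abs_nonneg _).trans a₁)

theorem IsLocBddKernel.ofFun_prod {k₁ k₂ : ℝ → ℝ → ℝ} (h₁ : IsLocBddKernel k₁)
    (h₂ : IsLocBddKernel k₂) (x : ℝ × ℝ) :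
    (ofFun fun t : ℝ × ℝ => k₁ t.1 x.1 * k₂ t.2 x.2 : Dist2) =
      tensor (ofFun fun t => k₁ t x.1) (ofFun fun t => k₂ t x.2) :=
  (tensor_ofFun_ofFun (h₁.locallyIntegrable_left x.1) (h₂.locallyIntegrable_left x.2)).2.symm

variable {E : Type} [NormedAddCommGroup E] [NormedSpace ℝ E] [FiniteDimensional ℝ E]
  [MeasureSpace E] [BorelSpace E] [IsLocallyFiniteMeasure (volume : Measure E)]

/-- The distribution `∫ K(·, x) dm(x)`, as a linear function of the measure `m`. -/
def IsLocBddKernel.potential {K : E → E → ℝ} (hK : IsLocBddKernel K) :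
    SignedMeasure E →ₗ[ℝ] Distribution (⊤ : Opens E) ℝ ⊤ where
  toFun m := ofFun fun t => ∫ᵛ x, K t x ∂•m
  map_add' m m' := by
    rw [← ofFun_add (hK.locallyIntegrable_integral m) (hK.locallyIntegrable_integral m')]
    congr 1
    ext t
    exact VectorMeasure.integral_add_vectorMeasure (hK.integrable m t) (hK.integrable m' t)
  map_smul' c m := by
    rw [RingHom.id_apply, ← ofFun_smul c (hK.locallyIntegrable_integral m)]
    congr 1
    ext t
    exact VectorMeasure.integral_smul_vectorMeasure _ _

end Potentials

/-! ### The right inverse on the line -/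

section Line

variable {α : ℝ} {N : ℕ} {p : Fin N → ℝ → ℝ} {φ : Fin N → Test1}

namespace IsAdmissible

variable (h : IsAdmissible α N p φ) (hN : 1 ≤ N)
include h hN

/-- Transposed to the test function and then moved under the integral, the operator acts on each
column `g_φ(·, x)` and yields `δ_x`. -/
theorem ode_inv1 (m : SignedMeasure ℝ) : ode α N (ofFun (inv1 α p φ m)) = ofMeasure m := by
  ext ψ
  rw [ode, diffOp_apply]
  refine ((h.isLocBddKernel hN).ofFun_integral m _).2.trans ?_
  rw [ofMeasure_apply]
  congr 1
  ext x
  rw [← diffOp_apply, ← ode, h.ode_ofFun_kernel hN, Distribution.delta_apply]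

theorem inv1_apply_test (m : SignedMeasure ℝ) (n : Fin N) :
    ofFun (inv1 α p φ m) (φ n) = 0 := by
  refine ((h.isLocBddKernel hN).ofFun_integral m _).2.trans ?_
  simp [h.ofFun_kernel_apply_test]

theorem projNull_inv1 (m : SignedMeasure ℝ) : projNull p φ (ofFun (inv1 α p φ m)) = 0 := by
  change ∑ n, ofFun (inv1 α p φ m) (φ n) • (ofFun (p n) : Dist1) = 0
  simp [h.inv1_apply_test hN]

/-- Potentials depend linearly on the measure, so they already form a subspace and the span adds
nothing. -/
theorem invSpace_eq : invSpace α p φ = LinearMap.range (h.isLocBddKernel hN).potential :=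
  Submodule.span_eq (LinearMap.range (h.isLocBddKernel hN).potential)

end IsAdmissible

end Line

/-- The parameters of the representation of an element of the native space. -/
abbrev Coord (N₁ N₂ : ℕ) : Type :=
  SignedMeasure (ℝ × ℝ) × (Fin N₁ → SignedMeasure ℝ) × (Fin N₂ → SignedMeasure ℝ) ×
    Matrix (Fin N₁) (Fin N₂) ℝ

/-! ### Synthesis and analysis on the plane -/

section Plane

variable {α₁ α₂ : ℝ} {N₁ N₂ : ℕ} {p₁ : Fin N₁ → ℝ → ℝ} {φ₁ : Fin N₁ → Test1}
  {p₂ : Fin N₂ → ℝ → ℝ} {φ₂ : Fin N₂ → Test1}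

variable (p₁ p₂) in
/-- The values of the four operators on the element with given parameters. -/
def target (r : Coord N₁ N₂) : Fin 4 → Dist2 :=
  ![ofMeasure r.1, sumLeft p₁ fun n => ofMeasure (r.2.1 n),
    sumRight p₂ fun n => ofMeasure (r.2.2.1 n), sumBoth p₁ p₂ r.2.2.2]

/-- The parameters of the four components. -/
def coordProj (i : Fin 4) (r : Coord N₁ N₂) : Coord N₁ N₂ :=
  (![(r.1, 0, 0, 0), (0, r.2.1, 0, 0), (0, 0, r.2.2.1, 0), (0, 0, 0, r.2.2.2)] :
    Fin 4 → Coord N₁ N₂) i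

variable (α₁ α₂ p₁ φ₁ p₂ φ₂) in
/-- The four summands, as functions of all the parameters. -/
def part (r : Coord N₁ N₂) : Fin 4 → Dist2 :=
  summand α₁ α₂ p₁ φ₁ p₂ φ₂ r.1 r.2.1 r.2.2.1 r.2.2.2

theorem part_at_zero (r : Coord N₁ N₂) :
    part α₁ α₂ p₁ φ₁ p₂ φ₂ r 0 = ofFun (inv2 α₁ α₂ p₁ φ₁ p₂ φ₂ r.1) := rfl

theorem part_at_one (r : Coord N₁ N₂) : part α₁ α₂ p₁ φ₁ p₂ φ₂ r 1 =
    ∑ n, tensor (ofFun (p₁ n)) (ofFun (inv1 α₂ p₂ φ₂ (r.2.1 n))) := rfl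

theorem part_at_two (r : Coord N₁ N₂) : part α₁ α₂ p₁ φ₁ p₂ φ₂ r 2 =
    ∑ n, tensor (ofFun (inv1 α₁ p₁ φ₁ (r.2.2.1 n))) (ofFun (p₂ n)) := rfl

theorem part_at_three (r : Coord N₁ N₂) : part α₁ α₂ p₁ φ₁ p₂ φ₂ r 3 =
    ∑ n, ∑ n', r.2.2.2 n n' • tensor (ofFun (p₁ n)) (ofFun (p₂ n')) := rfl

variable (h₁ : IsAdmissible α₁ N₁ p₁ φ₁) (h₂ : IsAdmissible α₂ N₂ p₂ φ₂)
  (hN₁ : 1 ≤ N₁) (hN₂ : 1 ≤ N₂)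

section
include h₁

theorem evalFst_sumLeft (S : Fin N₁ → Dist1) (k : Fin N₁) :
    evalFst (φ₁ k) (sumLeft p₁ S) = S k := by
  simp [sumLeft, evalFst_tensor, h₁.ofFun_apply_test]

theorem evalSnd_sumRight (S : Fin N₁ → Dist1) (k : Fin N₁) :
    evalSnd (φ₁ k) (sumRight p₁ S) = S k := by
  simp [sumRight, evalSnd_tensor, h₁.ofFun_apply_test]

end

theorem sumBoth_eq_sumLeft (d : Matrix (Fin N₁) (Fin N₂) ℝ) :
    sumBoth p₁ p₂ d = sumLeft p₁ fun n => ∑ n', d n n' • ofFun (p₂ n') := by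
  simp [sumBoth, sumLeft]

section
include h₁ h₂

/-- Pairing with `φ₁ k` isolates row `k`, whose entries are coefficients in the independent family
`p₂`. -/
theorem sumBoth_injective : Function.Injective (sumBoth p₁ p₂) := by
  intro d d' h
  ext k l
  have h3 := congrArg (fun T => evalFst (φ₁ k) T) h
  simp only [sumBoth_eq_sumLeft, evalFst_sumLeft h₁] at h3
  have h4 := Fintype.linearIndependent_iff.1 h₂.linearIndependent (fun n' => d k n' - d' k n')
    (by simp only [sub_smul, Finset.sum_sub_distrib, h3, sub_self]) l
  exact sub_eq_zero.1 h4

/-- The test functions isolate the individual measures, and a measure is determined by its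
distribution. The conclusion uses `coordProj` since the type of the parameters varies with `i`. -/
theorem target_injective (i : Fin 4) {r r' : Coord N₁ N₂}
    (h : target p₁ p₂ r i = target p₁ p₂ r' i) : coordProj i r = coordProj i r' := by
  fin_cases i
  · exact congrArg (fun m => ((m, 0, 0, 0) : Coord N₁ N₂)) (ofMeasure_injective h)
  · refine congrArg (fun m => ((0, m, 0, 0) : Coord N₁ N₂)) (funext fun k => ofMeasure_injective ?_)
    have := congrArg (fun T => evalFst (φ₁ k) T) h
    simpa [target, evalFst_sumLeft h₁] using this
  · refine congrArg (fun m => ((0, 0, m, 0) : Coord N₁ N₂)) (funext fun k => ofMeasure_injective ?_)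
    have := congrArg (fun T => evalSnd (φ₂ k) T) h
    simpa [target, evalSnd_sumRight h₂] using this
  · exact congrArg (fun m => ((0, 0, 0, m) : Coord N₁ N₂)) (sumBoth_injective h₁ h₂ h)

include hN₁ hN₂

/-- Each column of the product kernel is a pure tensor, so the rules for pure tensors apply under
the integral. -/
theorem inv2_apply (m : SignedMeasure (ℝ × ℝ)) (χ : Test2) :
    ofFun (inv2 α₁ α₂ p₁ φ₁ p₂ φ₂ m) χ =
      ∫ᵛ x, tensor (ofFun fun t => kernel α₁ p₁ φ₁ t x.1)
        (ofFun fun t => kernel α₂ p₂ φ₂ t x.2) χ ∂•m := by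
  have k₁ := h₁.isLocBddKernel hN₁
  have k₂ := h₂.isLocBddKernel hN₂
  refine ((k₁.prod k₂).ofFun_integral m χ).2.trans ?_
  simp only [k₁.ofFun_prod k₂]

theorem opLL_inv2 (m : SignedMeasure (ℝ × ℝ)) :
    opLL α₁ α₂ N₁ N₂ (ofFun (inv2 α₁ α₂ p₁ φ₁ p₂ φ₂ m)) = ofMeasure m := by
  have hop : ∀ (T : Dist2) (ψ : Test2), opLL α₁ α₂ N₁ N₂ T ψ =
      T ((adjOp ((0, 1) : ℝ × ℝ) α₂ ^ N₂) ((adjOp ((1, 0) : ℝ × ℝ) α₁ ^ N₁) ψ)) := fun T ψ => by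
    rw [opLL, Module.End.mul_apply, diffOp_apply, diffOp_apply]
  ext ψ
  rw [hop, inv2_apply h₁ h₂ hN₁ hN₂, ofMeasure_apply]
  congr 1
  ext x
  rw [← hop, opLL_tensor, h₁.ode_ofFun_kernel hN₁, h₂.ode_ofFun_kernel hN₂]
  rfl

theorem evalFst_inv2 (m : SignedMeasure (ℝ × ℝ)) (n : Fin N₁) :
    evalFst (φ₁ n) (ofFun (inv2 α₁ α₂ p₁ φ₁ p₂ φ₂ m)) = 0 := by
  ext ψ
  refine (inv2_apply h₁ h₂ hN₁ hN₂ m _).trans ?_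
  simp [tensorTestLeft_apply, tensor_tensorTest, h₁.ofFun_kernel_apply_test]

theorem evalSnd_inv2 (m : SignedMeasure (ℝ × ℝ)) (n : Fin N₂) :
    evalSnd (φ₂ n) (ofFun (inv2 α₁ α₂ p₁ φ₁ p₂ φ₂ m)) = 0 := by
  ext ψ
  refine (inv2_apply h₁ h₂ hN₁ hN₂ m _).trans ?_
  simp [tensorTestRight_apply, tensor_tensorTest, h₂.ofFun_kernel_apply_test]

/-- Off the diagonal some factor is `L` on the null space or a projector on a potential, hence zero;
on the diagonal each factor recovers a measure or fixes a `p_n`. The potential of a planar measure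
need not be a finite sum of pure tensors, so `j = 0` is handled through the columns of the kernel.
-/
theorem analysisOp_part (r : Coord N₁ N₂) (i j : Fin 4) :
    analysisOp α₁ α₂ p₁ φ₁ p₂ φ₂ i (part α₁ α₂ p₁ φ₁ p₂ φ₂ r j) =
      if i = j then target p₁ p₂ r i else 0 := by
  revert j
  refine forall_fin_four ?_ ?_ ?_ ?_
  · rw [part_at_zero]
    have e1 := evalFst_inv2 h₁ h₂ hN₁ hN₂ r.1
    have e2 := evalSnd_inv2 h₁ h₂ hN₁ hN₂ r.1
    fin_cases i
    · exact opLL_inv2 h₁ h₂ hN₁ hN₂ r.1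
    · simp [analysisOp, opProjFst, e1]
    · simp [analysisOp, opProjSnd, e2]
    · simp [analysisOp, opProjFst, e1]
  · rw [part_at_one, map_sum]
    simp only [analysisOp_tensor]
    fin_cases i <;> simp [fstFactor, sndFactor, h₁.ode_ofFun, h₁.projNull_ofFun,
      h₂.ode_inv1 hN₂, h₂.projNull_inv1 hN₂, target, sumLeft]
  · rw [part_at_two, map_sum]
    simp only [analysisOp_tensor]
    fin_cases i <;> simp [fstFactor, sndFactor, h₂.ode_ofFun, h₂.projNull_ofFun,
      h₁.ode_inv1 hN₁, h₁.projNull_inv1 hN₁, target, sumRight]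
  · rw [part_at_three]
    simp only [map_sum, map_smul, analysisOp_tensor]
    fin_cases i <;> simp [fstFactor, sndFactor, h₁.ode_ofFun, h₁.projNull_ofFun,
      h₂.ode_ofFun, h₂.projNull_ofFun, target, sumBoth]

theorem part_add (r r' : Coord N₁ N₂) (i : Fin 4) :
    part α₁ α₂ p₁ φ₁ p₂ φ₂ (r + r') i =
      part α₁ α₂ p₁ φ₁ p₂ φ₂ r i + part α₁ α₂ p₁ φ₁ p₂ φ₂ r' i := by
  have k₁ := h₁.isLocBddKernel hN₁
  have k₂ := h₂.isLocBddKernel hN₂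
  have e₁ : ∀ m m', (ofFun (inv1 α₁ p₁ φ₁ (m + m')) : Dist1) = _ := map_add k₁.potential
  have e₂ : ∀ m m', (ofFun (inv1 α₂ p₂ φ₂ (m + m')) : Dist1) = _ := map_add k₂.potential
  fin_cases i
  · exact map_add (k₁.prod k₂).potential r.1 r'.1
  · simp [part, summand, sumLeft, e₂, Finset.sum_add_distrib]; rfl
  · simp [part, summand, sumRight, e₁, Finset.sum_add_distrib]; rfl
  · simp [part, summand, sumBoth, add_smul, Finset.sum_add_distrib]

theorem part_smul (c : ℝ) (r : Coord N₁ N₂) (i : Fin 4) :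
    part α₁ α₂ p₁ φ₁ p₂ φ₂ (c • r) i = c • part α₁ α₂ p₁ φ₁ p₂ φ₂ r i := by
  have k₁ := h₁.isLocBddKernel hN₁
  have k₂ := h₂.isLocBddKernel hN₂
  have e₁ : ∀ m, (ofFun (inv1 α₁ p₁ φ₁ (c • m)) : Dist1) = _ := map_smul k₁.potential c
  have e₂ : ∀ m, (ofFun (inv1 α₂ p₂ φ₂ (c • m)) : Dist1) = _ := map_smul k₂.potential c
  fin_cases i
  · exact map_smul (k₁.prod k₂).potential c r.1
  · simp [part, summand, sumLeft, e₂, Finset.smul_sum]; rfl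
  · simp [part, summand, sumRight, e₁, Finset.smul_sum]; rfl
  · simp [part, summand, sumBoth, mul_smul, Finset.smul_sum]

end

/-- The four summands, as linear maps. -/
def partLin (h₁ : IsAdmissible α₁ N₁ p₁ φ₁) (h₂ : IsAdmissible α₂ N₂ p₂ φ₂)
    (hN₁ : 1 ≤ N₁) (hN₂ : 1 ≤ N₂) (i : Fin 4) : Coord N₁ N₂ →ₗ[ℝ] Dist2 where
  toFun r := part α₁ α₂ p₁ φ₁ p₂ φ₂ r i
  map_add' r r' := part_add h₁ h₂ hN₁ hN₂ r r' i
  map_smul' c r := part_smul h₁ h₂ hN₁ hN₂ c r i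

/-- The synthesis map, as a linear map. -/
def synthLin (h₁ : IsAdmissible α₁ N₁ p₁ φ₁) (h₂ : IsAdmissible α₂ N₂ p₂ φ₂)
    (hN₁ : 1 ≤ N₁) (hN₂ : 1 ≤ N₂) : Coord N₁ N₂ →ₗ[ℝ] Dist2 :=
  ∑ i, partLin h₁ h₂ hN₁ hN₂ i

theorem synthLin_apply (r : Coord N₁ N₂) :
    synthLin h₁ h₂ hN₁ hN₂ r = ∑ i, part α₁ α₂ p₁ φ₁ p₂ φ₂ r i :=
  LinearMap.sum_apply _ _ _

theorem part_coordProj_self (r : Coord N₁ N₂) (i : Fin 4) :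
    part α₁ α₂ p₁ φ₁ p₂ φ₂ (coordProj i r) i = part α₁ α₂ p₁ φ₁ p₂ φ₂ r i := by
  revert i
  refine forall_fin_four ?_ ?_ ?_ ?_
  · rw [part_at_zero, part_at_zero]; rfl
  · rw [part_at_one, part_at_one]; rfl
  · rw [part_at_two, part_at_two]; rfl
  · rw [part_at_three, part_at_three]; rfl

section
include h₁ h₂ hN₁ hN₂

theorem part_zero (i : Fin 4) : part α₁ α₂ p₁ φ₁ p₂ φ₂ (0 : Coord N₁ N₂) i = 0 := by
  exact map_zero (partLin h₁ h₂ hN₁ hN₂ i)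

theorem part_coordProj_of_ne (r : Coord N₁ N₂) {i j : Fin 4} (hij : j ≠ i) :
    part α₁ α₂ p₁ φ₁ p₂ φ₂ (coordProj i r) j = 0 := by
  have h : ∀ i j : Fin 4, j ≠ i → coordProj j (coordProj i r) = (0 : Coord N₁ N₂) := by
    refine forall_fin_four ?_ ?_ ?_ ?_ <;> refine forall_fin_four ?_ ?_ ?_ ?_ <;> intro h <;>
      first | exact absurd rfl h | rfl
  rw [← part_coordProj_self, h i j hij, part_zero h₁ h₂ hN₁ hN₂]

theorem synthLin_coordProj (r : Coord N₁ N₂) (i : Fin 4) :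
    synthLin h₁ h₂ hN₁ hN₂ (coordProj i r) = part α₁ α₂ p₁ φ₁ p₂ φ₂ r i := by
  rw [synthLin_apply, Finset.sum_eq_single i
    (fun j _ hj => part_coordProj_of_ne h₁ h₂ hN₁ hN₂ r hj) (by simp), part_coordProj_self]

omit hN₁ hN₂ in
theorem part_mem_component (r : Coord N₁ N₂) (i : Fin 4) :
    part α₁ α₂ p₁ φ₁ p₂ φ₂ r i ∈ component α₁ α₂ p₁ φ₁ p₂ φ₂ i := by
  have m₁ : ∀ m, (ofFun (inv1 α₁ p₁ φ₁ m) : Dist1) ∈ invSpace α₁ p₁ φ₁ :=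
    fun m => Submodule.subset_span ⟨m, rfl⟩
  have m₂ : ∀ m, (ofFun (inv1 α₂ p₂ φ₂ m) : Dist1) ∈ invSpace α₂ p₂ φ₂ :=
    fun m => Submodule.subset_span ⟨m, rfl⟩
  revert i
  refine forall_fin_four ?_ ?_ ?_ ?_
  · exact Submodule.subset_span ⟨r.1, rfl⟩
  · change sumLeft p₁ _ ∈ Submodule.map₂ tensor (nullSpace α₁ N₁) (invSpace α₂ p₂ φ₂)
    exact Submodule.sum_mem _ fun n _ => Submodule.apply_mem_map₂ _ (h₁.mem_nullSpace n) (m₂ _)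
  · change sumRight p₂ _ ∈ Submodule.map₂ tensor (invSpace α₁ p₁ φ₁) (nullSpace α₂ N₂)
    exact Submodule.sum_mem _ fun n _ => Submodule.apply_mem_map₂ _ (m₁ _) (h₂.mem_nullSpace n)
  · change sumBoth p₁ p₂ _ ∈ Submodule.map₂ tensor (nullSpace α₁ N₁) (nullSpace α₂ N₂)
    exact Submodule.sum_mem _ fun n _ => Submodule.sum_mem _ fun n' _ => Submodule.smul_mem _ _
      (Submodule.apply_mem_map₂ _ (h₁.mem_nullSpace n) (h₂.mem_nullSpace n'))

/-- Expanding the null-space factor in its basis moves scalars onto the measure: `u ⊗ L_φ⁻¹ m = ∑ₙ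
pₙ ⊗ L_φ⁻¹ (⟨u, φₙ⟩ m)`. The spans of pure tensors thus contain only the parametrized sums. -/
theorem component_le (i : Fin 4) : component α₁ α₂ p₁ φ₁ p₂ φ₂ i ≤
    LinearMap.range (partLin h₁ h₂ hN₁ hN₂ i) := by
  have key : ∀ r i, part α₁ α₂ p₁ φ₁ p₂ φ₂ r i ∈ LinearMap.range (partLin h₁ h₂ hN₁ hN₂ i) :=
    fun r i => ⟨r, rfl⟩
  have k₁ := h₁.isLocBddKernel hN₁
  have k₂ := h₂.isLocBddKernel hN₂
  have e₁ : ∀ c m, (ofFun (inv1 α₁ p₁ φ₁ (c • m)) : Dist1) = _ := map_smul k₁.potential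
  have e₂ : ∀ c m, (ofFun (inv1 α₂ p₂ φ₂ (c • m)) : Dist1) = _ := map_smul k₂.potential
  have x₁ : ∀ u ∈ nullSpace α₁ N₁, u = ∑ n, u (φ₁ n) • (ofFun (p₁ n) : Dist1) :=
    fun u hu => (h₁.projNull_eq_self hu).symm
  have x₂ : ∀ u ∈ nullSpace α₂ N₂, u = ∑ n, u (φ₂ n) • (ofFun (p₂ n) : Dist1) :=
    fun u hu => (h₂.projNull_eq_self hu).symm
  revert i
  refine forall_fin_four ?_ ?_ ?_ ?_
  · refine Submodule.span_le.2 ?_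
    rintro - ⟨m, rfl⟩
    exact key (m, 0, 0, 0) 0
  · refine Submodule.map₂_le.2 fun u hu v hv => ?_
    rw [h₂.invSpace_eq hN₂] at hv
    obtain ⟨m, rfl⟩ := hv
    convert key (0, fun n => u (φ₁ n) • m, 0, 0) 1 using 1
    conv_lhs => rw [x₁ u hu]
    simp [part, summand, sumLeft, e₂]
  · refine Submodule.map₂_le.2 fun u hu v hv => ?_
    rw [h₁.invSpace_eq hN₁] at hu
    obtain ⟨m, rfl⟩ := hu
    convert key (0, 0, fun n => v (φ₂ n) • m, 0) 2 using 1
    conv_lhs => rw [x₂ v hv]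
    simp [part, summand, sumRight, e₁]
  · refine Submodule.map₂_le.2 fun u hu v hv => ?_
    convert key (0, 0, 0, Matrix.of fun n n' => u (φ₁ n) * v (φ₂ n')) 3 using 1
    conv_lhs => rw [x₁ u hu, x₂ v hv]
    simp only [map_sum, map_smul, LinearMap.sum_apply, LinearMap.smul_apply, Finset.smul_sum]
    rw [Finset.sum_comm]
    simp [part, summand, sumBoth, mul_smul, smul_comm (v _)]

theorem exists_part_of_mem_component {i : Fin 4} {f : Dist2}
    (hf : f ∈ component α₁ α₂ p₁ φ₁ p₂ φ₂ i) : ∃ r, f = part α₁ α₂ p₁ φ₁ p₂ φ₂ r i := by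
  obtain ⟨r, rfl⟩ := component_le h₁ h₂ hN₁ hN₂ i hf
  exact ⟨r, rfl⟩

theorem native_eq : native α₁ α₂ p₁ φ₁ p₂ φ₂ = LinearMap.range (synthLin h₁ h₂ hN₁ hN₂) := by
  refine le_antisymm (iSup_le fun i f hf => ?_) ?_
  · obtain ⟨r, rfl⟩ := component_le h₁ h₂ hN₁ hN₂ i hf
    exact ⟨_, synthLin_coordProj h₁ h₂ hN₁ hN₂ r i⟩
  · rintro - ⟨r, rfl⟩
    rw [synthLin_apply]
    exact Submodule.sum_mem _ fun i _ =>
      (le_iSup (component α₁ α₂ p₁ φ₁ p₂ φ₂) i) (part_mem_component h₁ h₂ r i)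

theorem analysisOp_synthLin (r : Coord N₁ N₂) (i : Fin 4) :
    analysisOp α₁ α₂ p₁ φ₁ p₂ φ₂ i (synthLin h₁ h₂ hN₁ hN₂ r) = target p₁ p₂ r i := by
  simp [synthLin_apply, map_sum, analysisOp_part h₁ h₂ hN₁ hN₂]

theorem synthLin_injective : Function.Injective (synthLin h₁ h₂ hN₁ hN₂) := by
  intro r r' h
  have key : ∀ i, coordProj i r = coordProj i r' := fun i => by
    refine target_injective h₁ h₂ i ?_
    rw [← analysisOp_synthLin h₁ h₂ hN₁ hN₂, ← analysisOp_synthLin h₁ h₂ hN₁ hN₂, h]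
  have e0 := congrArg (fun s : Coord N₁ N₂ => s.1) (key 0)
  have e1 := congrArg (fun s : Coord N₁ N₂ => s.2.1) (key 1)
  have e2 := congrArg (fun s : Coord N₁ N₂ => s.2.2.1) (key 2)
  have e3 := congrArg (fun s : Coord N₁ N₂ => s.2.2.2) (key 3)
  exact Prod.ext e0 (Prod.ext e1 (Prod.ext e2 e3))

/-- The operator with index `i` annihilates the other components and is injective on its own. -/
theorem iSupIndep_component : iSupIndep (component α₁ α₂ p₁ φ₁ p₂ φ₂) := by
  intro i
  have hle : ⨆ j, ⨆ (_ : j ≠ i), component α₁ α₂ p₁ φ₁ p₂ φ₂ j ≤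
      LinearMap.ker (analysisOp α₁ α₂ p₁ φ₁ p₂ φ₂ i) := by
    refine iSup₂_le fun j hj f hf => ?_
    obtain ⟨r, rfl⟩ := exists_part_of_mem_component h₁ h₂ hN₁ hN₂ hf
    rw [LinearMap.mem_ker, analysisOp_part h₁ h₂ hN₁ hN₂, if_neg hj.symm]
  rw [Submodule.disjoint_def]
  intro f hf hf'
  obtain ⟨r, rfl⟩ := exists_part_of_mem_component h₁ h₂ hN₁ hN₂ hf
  have h0 := LinearMap.mem_ker.1 (hle hf')
  have hz : target p₁ p₂ (0 : Coord N₁ N₂) i = 0 := by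
    rw [← analysisOp_synthLin h₁ h₂ hN₁ hN₂, map_zero, map_zero]
  rw [analysisOp_part h₁ h₂ hN₁ hN₂, if_pos rfl, ← hz] at h0
  rw [← part_coordProj_self, target_injective h₁ h₂ i h0, part_coordProj_self,
    part_zero h₁ h₂ hN₁ hN₂]

end

/-! ### Norms of the parameters -/

section Norms

/-- The norms of the four groups of parameters. -/
def coordNorm (r : Coord N₁ N₂) : Fin 4 → ℝ≥0∞ :=
  ![r.1.variation univ, ∑ n, (r.2.1 n).variation univ, ∑ n, (r.2.2.1 n).variation univ,
    ∑ n, ∑ n', ‖r.2.2.2 n n'‖ₑ]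

/-- The sum of the norms of all the parameters, as a real number. -/
def paramNorm (r : Coord N₁ N₂) : ℝ :=
  tv r.1 + ∑ n, tv (r.2.1 n) + ∑ n, tv (r.2.2.1 n) + ∑ n, ∑ n', ‖r.2.2.2 n n'‖

theorem ofReal_sum_norm (d : Matrix (Fin N₁) (Fin N₂) ℝ) :
    ENNReal.ofReal (∑ n, ∑ n', ‖d n n'‖) = ∑ n, ∑ n', ‖d n n'‖ₑ := by
  have key : ∀ d : Fin N₁ → Fin N₂ → ℝ,
      ENNReal.ofReal (∑ n, ∑ n', ‖d n n'‖) = ∑ n, ∑ n', ‖d n n'‖ₑ := fun d => by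
    rw [ENNReal.ofReal_sum_of_nonneg fun n _ => Finset.sum_nonneg fun n' _ => norm_nonneg _]
    refine Finset.sum_congr rfl fun n _ => ?_
    rw [ENNReal.ofReal_sum_of_nonneg fun n' _ => norm_nonneg _]
    simp only [ofReal_norm]
  exact key d

theorem ofReal_sum_tv {ι : Type} [Fintype ι] (m : ι → SignedMeasure ℝ) :
    ENNReal.ofReal (∑ n, tv (m n)) = ∑ n, (m n).variation univ := by
  rw [ENNReal.ofReal_sum_of_nonneg fun n _ => tv_nonneg _]
  simp only [ofReal_tv]

theorem ofReal_paramNorm (r : Coord N₁ N₂) :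
    ENNReal.ofReal (paramNorm r) = ∑ i, coordNorm r i := by
  have s₁ : 0 ≤ ∑ n, tv (r.2.1 n) := Finset.sum_nonneg fun n _ => tv_nonneg _
  have s₂ : 0 ≤ ∑ n, tv (r.2.2.1 n) := Finset.sum_nonneg fun n _ => tv_nonneg _
  have s₃ : 0 ≤ ∑ n, ∑ n', ‖r.2.2.2 n n'‖ :=
    Finset.sum_nonneg fun n _ => Finset.sum_nonneg fun n' _ => norm_nonneg _
  have s₀ := tv_nonneg r.1
  rw [paramNorm, ENNReal.ofReal_add (by positivity) s₃, ENNReal.ofReal_add (by positivity) s₂,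
    ENNReal.ofReal_add s₀ s₁, ofReal_tv, ofReal_sum_tv, ofReal_sum_tv, ofReal_sum_norm,
    Fin.sum_univ_four]
  rfl

theorem paramNorm_add_le (r r' : Coord N₁ N₂) :
    paramNorm (r + r') ≤ paramNorm r + paramNorm r' := by
  have t₀ := tv_add_le r.1 r'.1
  have t₁ := Finset.sum_le_sum fun n (_ : n ∈ Finset.univ) => tv_add_le (r.2.1 n) (r'.2.1 n)
  have t₂ := Finset.sum_le_sum fun n (_ : n ∈ Finset.univ) => tv_add_le (r.2.2.1 n) (r'.2.2.1 n)
  have t₃ := Finset.sum_le_sum fun n (_ : n ∈ Finset.univ) =>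
    Finset.sum_le_sum fun n' (_ : n' ∈ Finset.univ) => norm_add_le (r.2.2.2 n n') (r'.2.2.2 n n')
  simp only [Finset.sum_add_distrib] at t₁ t₂ t₃
  simp only [paramNorm, Prod.fst_add, Prod.snd_add, Pi.add_apply, Matrix.add_apply]
  linarith

theorem paramNorm_smul (c : ℝ) (r : Coord N₁ N₂) : paramNorm (c • r) = ‖c‖ * paramNorm r := by
  simp [paramNorm, tv_smul, Finset.mul_sum, mul_add]

theorem paramNorm_bounds (r : Coord N₁ N₂) :
    tv r.1 ≤ paramNorm r ∧ (∀ n, tv (r.2.1 n) ≤ paramNorm r) ∧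
      (∀ n, tv (r.2.2.1 n) ≤ paramNorm r) ∧ ∀ n n', ‖r.2.2.2 n n'‖ ≤ paramNorm r := by
  have s₁ : 0 ≤ ∑ n, tv (r.2.1 n) := Finset.sum_nonneg fun n _ => tv_nonneg _
  have s₂ : 0 ≤ ∑ n, tv (r.2.2.1 n) := Finset.sum_nonneg fun n _ => tv_nonneg _
  have s₃ : 0 ≤ ∑ n, ∑ n', ‖r.2.2.2 n n'‖ :=
    Finset.sum_nonneg fun n _ => Finset.sum_nonneg fun n' _ => norm_nonneg _
  have s₀ := tv_nonneg r.1
  have b₁ := fun n => Finset.single_le_sum (fun n _ => tv_nonneg (r.2.1 n)) (Finset.mem_univ n)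
  have b₂ := fun n => Finset.single_le_sum (fun n _ => tv_nonneg (r.2.2.1 n)) (Finset.mem_univ n)
  have b₃ := fun n => Finset.single_le_sum (f := fun n => ∑ n', ‖r.2.2.2 n n'‖)
    (fun n _ => Finset.sum_nonneg fun n' _ => norm_nonneg _) (Finset.mem_univ n)
  have b₄ := fun n n' => Finset.single_le_sum (f := fun n' => ‖r.2.2.2 n n'‖)
    (fun n' _ => norm_nonneg _) (Finset.mem_univ n')
  unfold paramNorm
  refine ⟨by linarith, fun n => ?_, fun n => ?_, fun n n' => ?_⟩
  · linarith [b₁ n]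
  · linarith [b₂ n]
  · linarith [b₃ n, b₄ n n']

theorem eq_zero_of_paramNorm_eq_zero {r : Coord N₁ N₂} (h : paramNorm r = 0) : r = 0 := by
  obtain ⟨b₀, b₁, b₂, b₃⟩ := paramNorm_bounds r
  rw [h] at b₀ b₁ b₂ b₃
  refine Prod.ext ?_ (Prod.ext (funext fun n => ?_) (Prod.ext (funext fun n => ?_)
    (Matrix.ext fun n n' => norm_le_zero_iff.1 (b₃ n n'))))
  · exact eq_zero_of_tv_eq_zero (b₀.antisymm (tv_nonneg _))
  · exact eq_zero_of_tv_eq_zero ((b₁ n).antisymm (tv_nonneg _))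
  · exact eq_zero_of_tv_eq_zero ((b₂ n).antisymm (tv_nonneg _))

/-- A finite `ℓ¹` sum of complete spaces: each entry is Cauchy because `paramNorm` dominates its
norm, and the limits are assembled. -/
theorem exists_tendsto_of_cauchy_paramNorm (u : ℕ → Coord N₁ N₂)
    (hu : ∀ ε > 0, ∃ K, ∀ i ≥ K, ∀ j ≥ K, paramNorm (u i - u j) < ε) :
    ∃ r, Filter.Tendsto (fun i => paramNorm (u i - r)) Filter.atTop (nhds 0) := by
  have hle : ∀ F : Coord N₁ N₂ → ℝ, (∀ r, F r ≤ paramNorm r) →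
      ∀ ε > 0, ∃ K, ∀ i ≥ K, ∀ j ≥ K, F (u i - u j) < ε := fun F hF ε hε => by
    obtain ⟨K, hK⟩ := hu ε hε
    exact ⟨K, fun i hi j hj => (hF _).trans_lt (hK i hi j hj)⟩
  obtain ⟨a, ha⟩ := exists_tendsto_of_cauchy_tv (fun i => (u i).1)
    (hle (fun r => tv r.1) fun r => (paramNorm_bounds r).1)
  choose b hb using fun n => exists_tendsto_of_cauchy_tv (fun i => (u i).2.1 n)
    (hle (fun r => tv (r.2.1 n)) fun r => (paramNorm_bounds r).2.1 n)
  choose c hc using fun n => exists_tendsto_of_cauchy_tv (fun i => (u i).2.2.1 n)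
    (hle (fun r => tv (r.2.2.1 n)) fun r => (paramNorm_bounds r).2.2.1 n)
  have hd : ∀ n n', ∃ d : ℝ, Filter.Tendsto (fun i => ‖(u i).2.2.2 n n' - d‖) Filter.atTop
      (nhds 0) := by
    intro n n'
    obtain ⟨d, hd⟩ := cauchySeq_tendsto_of_complete (u := fun i => (u i).2.2.2 n n')
      (Metric.cauchySeq_iff.2 (hle (fun r => ‖r.2.2.2 n n'‖)
        fun r => (paramNorm_bounds r).2.2.2 n n'))
    exact ⟨d, tendsto_iff_norm_sub_tendsto_zero.1 hd⟩
  choose d hd using hd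
  refine ⟨(a, b, c, Matrix.of d), ?_⟩
  have h := ((ha.add (tendsto_finsetSum Finset.univ fun n _ => hb n)).add
    (tendsto_finsetSum Finset.univ fun n _ => hc n)).add
    (tendsto_finsetSum Finset.univ fun n _ => tendsto_finsetSum Finset.univ fun n' _ => hd n n')
  simpa [paramNorm] using h

/-- The parametrizations are injective, so each infimum runs over a single representation. -/
theorem rangeNorm_target (h₁ : IsAdmissible α₁ N₁ p₁ φ₁) (h₂ : IsAdmissible α₂ N₂ p₂ φ₂)
    (r : Coord N₁ N₂) (i : Fin 4) :
    rangeNorm p₁ p₂ i (target p₁ p₂ r i) = coordNorm r i := by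
  revert i
  refine forall_fin_four ?_ ?_ ?_ ?_
  · change measNorm (ofMeasure r.1) = r.1.variation univ
    unfold measNorm
    refine le_antisymm (iInf₂_le_of_le r.1 (by rfl) le_rfl) (le_iInf₂ fun m hm => ?_)
    rw [ofMeasure_injective hm]
  · change leftNorm p₁ (sumLeft p₁ fun n => ofMeasure (r.2.1 n)) = ∑ n, (r.2.1 n).variation univ
    unfold leftNorm
    refine le_antisymm (iInf₂_le_of_le r.2.1 (by rfl) le_rfl) (le_iInf₂ fun m hm => ?_)
    -- The zeros are placeholders: the target with index `1` depends on the second entry only.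
    have e : m = r.2.1 := congrArg (fun s : Coord N₁ N₂ => s.2.1)
      (target_injective h₁ h₂ 1 (r := (0, m, 0, 0)) (r' := r) hm)
    rw [e]
  · change rightNorm p₂ (sumRight p₂ fun n => ofMeasure (r.2.2.1 n)) =
      ∑ n, (r.2.2.1 n).variation univ
    unfold rightNorm
    refine le_antisymm (iInf₂_le_of_le r.2.2.1 (by rfl) le_rfl) (le_iInf₂ fun m hm => ?_)
    have e : m = r.2.2.1 := congrArg (fun s : Coord N₁ N₂ => s.2.2.1)
      (target_injective h₁ h₂ 2 (r := (0, 0, m, 0)) (r' := r) hm)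
    rw [e]
  · change bothNorm p₁ p₂ (sumBoth p₁ p₂ r.2.2.2) = ∑ n, ∑ n', ‖r.2.2.2 n n'‖ₑ
    unfold bothNorm
    refine le_antisymm (iInf₂_le_of_le r.2.2.2 (by rfl) le_rfl) (le_iInf₂ fun d hd => ?_)
    rw [sumBoth_injective h₁ h₂ hd]

end Norms

end Plane

/-! ### The native norm -/

section Plane

variable {α₁ α₂ : ℝ} {N₁ N₂ : ℕ} {p₁ : Fin N₁ → ℝ → ℝ} {φ₁ : Fin N₁ → Test1}
  {p₂ : Fin N₂ → ℝ → ℝ} {φ₂ : Fin N₂ → Test1}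
variable (h₁ : IsAdmissible α₁ N₁ p₁ φ₁) (h₂ : IsAdmissible α₂ N₂ p₂ φ₂)
  (hN₁ : 1 ≤ N₁) (hN₂ : 1 ≤ N₂)

section
include h₁ h₂ hN₁ hN₂

theorem nativeNorm_synthLin (r : Coord N₁ N₂) :
    nativeNorm α₁ α₂ p₁ φ₁ p₂ φ₂ (synthLin h₁ h₂ hN₁ hN₂ r) = ∑ i, coordNorm r i := by
  simp only [nativeNorm, analysisOp_synthLin h₁ h₂ hN₁ hN₂, rangeNorm_target h₁ h₂]

theorem nativeNorm_part (r : Coord N₁ N₂) (i : Fin 4) :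
    nativeNorm α₁ α₂ p₁ φ₁ p₂ φ₂ (part α₁ α₂ p₁ φ₁ p₂ φ₂ r i) = coordNorm r i := by
  rw [← synthLin_coordProj h₁ h₂ hN₁ hN₂, nativeNorm_synthLin h₁ h₂ hN₁ hN₂, Fin.sum_univ_four]
  revert i
  refine forall_fin_four ?_ ?_ ?_ ?_ <;> simp [coordProj, coordNorm, VectorMeasure.variation_zero]

theorem nativeNorm_sum (v : Fin 4 → Dist2)
    (hv : ∀ i, v i ∈ component α₁ α₂ p₁ φ₁ p₂ φ₂ i) :
    nativeNorm α₁ α₂ p₁ φ₁ p₂ φ₂ (∑ i, v i) = ∑ i, nativeNorm α₁ α₂ p₁ φ₁ p₂ φ₂ (v i) := by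
  choose r hr using fun i => exists_part_of_mem_component h₁ h₂ hN₁ hN₂ (hv i)
  -- The summand with index `i` depends on the `i`-th group of parameters alone, so the four
  -- representations merge into one.
  let w : Coord N₁ N₂ := ((r 0).1, (r 1).2.1, (r 2).2.2.1, (r 3).2.2.2)
  have hw : ∀ i, part α₁ α₂ p₁ φ₁ p₂ φ₂ (r i) i = part α₁ α₂ p₁ φ₁ p₂ φ₂ w i := by
    refine forall_fin_four ?_ ?_ ?_ ?_
    · rw [part_at_zero, part_at_zero]
    · rw [part_at_one, part_at_one]
    · rw [part_at_two, part_at_two]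
    · rw [part_at_three, part_at_three]
  simp only [hr, hw]
  rw [← synthLin_apply h₁ h₂ hN₁ hN₂, nativeNorm_synthLin h₁ h₂ hN₁ hN₂]
  simp only [nativeNorm_part h₁ h₂ hN₁ hN₂]

/-- Synthesis is a linear bijection from the parameters onto the native space; `ν` is `paramNorm`
transported along it, and inherits definiteness and completeness. -/
theorem exists_banachNorm : ∃ ν : Seminorm ℝ (native α₁ α₂ p₁ φ₁ p₂ φ₂),
    (∀ f, ENNReal.ofReal (ν f) = nativeNorm α₁ α₂ p₁ φ₁ p₂ φ₂ f) ∧ IsBanachNorm ν := by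
  have hsurj : ∀ f : native α₁ α₂ p₁ φ₁ p₂ φ₂, ∃ r, synthLin h₁ h₂ hN₁ hN₂ r = f :=
    fun f => (native_eq h₁ h₂ hN₁ hN₂).le f.2
  choose c hc using hsurj
  have hinj := synthLin_injective h₁ h₂ hN₁ hN₂
  -- The chosen inverse `c` is linear because synthesis is linear and injective.
  have hadd : ∀ f g, c (f + g) = c f + c g := fun f g => hinj (by
    rw [map_add, hc, hc, hc, Submodule.coe_add])
  have hsmul : ∀ (a : ℝ) f, c (a • f) = a • c f := fun a f => hinj (by
    rw [map_smul, hc, hc, Submodule.coe_smul])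
  have hsub : ∀ f g, c (f - g) = c f - c g := fun f g => hinj (by
    rw [map_sub, hc, hc, hc, Submodule.coe_sub])
  let ν : Seminorm ℝ (native α₁ α₂ p₁ φ₁ p₂ φ₂) := Seminorm.of (fun f => paramNorm (c f))
    (fun f g => by rw [hadd]; exact paramNorm_add_le _ _)
    (fun a f => by rw [hsmul]; exact paramNorm_smul _ _)
  have hν : ∀ f, ν f = paramNorm (c f) := fun _ => rfl
  refine ⟨ν, fun f => ?_, fun f hf => ?_, fun u hu => ?_⟩
  · rw [hν, ofReal_paramNorm, ← nativeNorm_synthLin h₁ h₂ hN₁ hN₂, hc]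
  · have h0 := eq_zero_of_paramNorm_eq_zero hf
    have := hc f
    rw [h0, map_zero] at this
    exact Subtype.ext this.symm
  · simp only [hν, hsub] at hu
    obtain ⟨r, hr⟩ := exists_tendsto_of_cauchy_paramNorm (fun i => c (u i)) hu
    let f : native α₁ α₂ p₁ φ₁ p₂ φ₂ := ⟨synthLin h₁ h₂ hN₁ hN₂ r, by
      rw [native_eq h₁ h₂ hN₁ hN₂]; exact ⟨r, rfl⟩⟩
    have hf : c f = r := hinj (hc f)
    refine ⟨f, ?_⟩
    simp only [hν, hsub, hf]
    exact hr

end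

end Plane

end TensorSpline

end

/-- Direct-sum decomposition, unique representation and Banach structure of the native space of
`L₁ ⊗ L₂`, where `Lᵢ = (D - αᵢ I) ^ Nᵢ`. -/
theorem mainTheorem4 (α₁ α₂ : ℝ) (N₁ N₂ : ℕ) (hN₁ : 1 ≤ N₁) (hN₂ : 1 ≤ N₂)
    (p₁ : Fin N₁ → ℝ → ℝ) (φ₁ : Fin N₁ → Test1) (p₂ : Fin N₂ → ℝ → ℝ) (φ₂ : Fin N₂ → Test1)
    (h₁ : IsAdmissible α₁ N₁ p₁ φ₁) (h₂ : IsAdmissible α₂ N₂ p₂ φ₂) :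
    -- the integral transforms are well posed
    (∀ m : SignedMeasure ℝ,
      (∀ t, m.Integrable (kernel α₁ p₁ φ₁ t)) ∧ LocallyIntegrable (inv1 α₁ p₁ φ₁ m) volume ∧
      (∀ t, m.Integrable (kernel α₂ p₂ φ₂ t)) ∧ LocallyIntegrable (inv1 α₂ p₂ φ₂ m) volume) ∧
    (∀ m : SignedMeasure (ℝ × ℝ),
      (∀ t : ℝ × ℝ, m.Integrable fun x => kernel α₁ p₁ φ₁ t.1 x.1 * kernel α₂ p₂ φ₂ t.2 x.2) ∧
      LocallyIntegrable (inv2 α₁ α₂ p₁ φ₁ p₂ φ₂ m) volume) ∧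
    -- the four components are in direct sum
    iSupIndep (component α₁ α₂ p₁ φ₁ p₂ φ₂) ∧
    -- every element of the native space has a unique representation, adapted to the direct sum
    (∀ f ∈ native α₁ α₂ p₁ φ₁ p₂ φ₂,
      ∃! r : SignedMeasure (ℝ × ℝ) × (Fin N₁ → SignedMeasure ℝ) × (Fin N₂ → SignedMeasure ℝ) ×
          Matrix (Fin N₁) (Fin N₂) ℝ,
        f = synth α₁ α₂ p₁ φ₁ p₂ φ₂ r.1 r.2.1 r.2.2.1 r.2.2.2) ∧
    (∀ m m₁ m₂ d i,
      summand α₁ α₂ p₁ φ₁ p₂ φ₂ m m₁ m₂ d i ∈ component α₁ α₂ p₁ φ₁ p₂ φ₂ i) ∧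
    -- the four operators are continuous extensions of the tensor products of the one-dimensional
    -- operators
    (∀ i : Fin 4, Continuous (analysisOp α₁ α₂ p₁ φ₁ p₂ φ₂ i)) ∧
    (∀ (i : Fin 4) (S T : Dist1), analysisOp α₁ α₂ p₁ φ₁ p₂ φ₂ i (tensor S T) =
      tensor (fstFactor α₁ p₁ φ₁ i S) (sndFactor α₂ p₂ φ₂ i T)) ∧
    -- on the native space they recover `m`, `m₁`, `m₂`, `d`
    (∀ m m₁ m₂ d, ∀ f, f = synth α₁ α₂ p₁ φ₁ p₂ φ₂ m m₁ m₂ d →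
      analysisOp α₁ α₂ p₁ φ₁ p₂ φ₂ 0 f = ofMeasure m ∧
      analysisOp α₁ α₂ p₁ φ₁ p₂ φ₂ 1 f = sumLeft p₁ (fun n => ofMeasure (m₁ n)) ∧
      analysisOp α₁ α₂ p₁ φ₁ p₂ φ₂ 2 f = sumRight p₂ (fun n => ofMeasure (m₂ n)) ∧
      analysisOp α₁ α₂ p₁ φ₁ p₂ φ₂ 3 f = sumBoth p₁ p₂ d ∧
      measNorm (analysisOp α₁ α₂ p₁ φ₁ p₂ φ₂ 0 f) = m.variation univ ∧
      leftNorm p₁ (analysisOp α₁ α₂ p₁ φ₁ p₂ φ₂ 1 f) = ∑ n, (m₁ n).variation univ ∧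
      rightNorm p₂ (analysisOp α₁ α₂ p₁ φ₁ p₂ φ₂ 2 f) = ∑ n, (m₂ n).variation univ ∧
      bothNorm p₁ p₂ (analysisOp α₁ α₂ p₁ φ₁ p₂ φ₂ 3 f) = ∑ n, ∑ n', ‖d n n'‖ₑ ∧
      nativeNorm α₁ α₂ p₁ φ₁ p₂ φ₂ f =
        m.variation univ + ∑ n, (m₁ n).variation univ + ∑ n, (m₂ n).variation univ +
          ∑ n, ∑ n', ‖d n n'‖ₑ ∧
      nativeNorm α₁ α₂ p₁ φ₁ p₂ φ₂ f < ∞) ∧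
    -- the native norm is a Banach norm, for which the direct sum is topological and the four
    -- operators are continuous
    (∃ ν : Seminorm ℝ (native α₁ α₂ p₁ φ₁ p₂ φ₂),
      (∀ f, ENNReal.ofReal (ν f) = nativeNorm α₁ α₂ p₁ φ₁ p₂ φ₂ f) ∧ IsBanachNorm ν) ∧
    (∀ v : Fin 4 → Dist2, (∀ i, v i ∈ component α₁ α₂ p₁ φ₁ p₂ φ₂ i) →
      nativeNorm α₁ α₂ p₁ φ₁ p₂ φ₂ (∑ i, v i) = ∑ i, nativeNorm α₁ α₂ p₁ φ₁ p₂ φ₂ (v i)) ∧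
    (∀ i, ∀ f ∈ native α₁ α₂ p₁ φ₁ p₂ φ₂,
      rangeNorm p₁ p₂ i (analysisOp α₁ α₂ p₁ φ₁ p₂ φ₂ i f) ≤
        nativeNorm α₁ α₂ p₁ φ₁ p₂ φ₂ f) := by
  have k₁ := h₁.isLocBddKernel hN₁
  have k₂ := h₂.isLocBddKernel hN₂
  have hsynth : ∀ r : Coord N₁ N₂, synth α₁ α₂ p₁ φ₁ p₂ φ₂ r.1 r.2.1 r.2.2.1 r.2.2.2 =
      synthLin h₁ h₂ hN₁ hN₂ r := fun r => (synthLin_apply h₁ h₂ hN₁ hN₂ r).symm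
  refine ⟨fun m => ⟨k₁.integrable m, k₁.locallyIntegrable_integral m, k₂.integrable m,
    k₂.locallyIntegrable_integral m⟩, fun m => ⟨(k₁.prod k₂).integrable m,
    (k₁.prod k₂).locallyIntegrable_integral m⟩, iSupIndep_component h₁ h₂ hN₁ hN₂,
    fun f hf => ?_, fun m m₁ m₂ d i => part_mem_component h₁ h₂ (m, m₁, m₂, d) i, ?_,
    analysisOp_tensor α₁ α₂ p₁ φ₁ p₂ φ₂, ?_, exists_banachNorm h₁ h₂ hN₁ hN₂,
    nativeNorm_sum h₁ h₂ hN₁ hN₂, fun i f _ => ?_⟩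
  · rw [native_eq h₁ h₂ hN₁ hN₂] at hf
    obtain ⟨r, rfl⟩ := hf
    refine ⟨r, (hsynth r).symm, fun r' hr' => ?_⟩
    exact (synthLin_injective h₁ h₂ hN₁ hN₂ (hr'.trans (hsynth r'))).symm
  · refine forall_fin_four ?_ ?_ ?_ ?_
    · exact (continuous_diffOp _ α₁ N₁).comp (continuous_diffOp _ α₂ N₂)
    · exact continuous_opProjFst p₁ φ₁ (continuous_diffOp _ α₂ N₂)
    -- Here the fixed function is the second tensor factor, so the Fubini theorem for `S ⊗ p`
    -- enters.
    · exact continuous_opProjSnd h₂.continuous φ₂ (continuous_diffOp _ α₁ N₁)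
    · exact continuous_opProjFst p₁ φ₁ (continuous_projNull p₂ φ₂)
  · intro m m₁ m₂ d f hf
    obtain rfl : f = synthLin h₁ h₂ hN₁ hN₂ (m, m₁, m₂, d) := hf.trans (hsynth (m, m₁, m₂, d))
    have hop := analysisOp_synthLin h₁ h₂ hN₁ hN₂ (m, m₁, m₂, d)
    have hr := rangeNorm_target h₁ h₂ (m, m₁, m₂, d)
    have hn := nativeNorm_synthLin h₁ h₂ hN₁ hN₂ (m, m₁, m₂, d)
    refine ⟨hop 0, hop 1, hop 2, hop 3, ?_, ?_, ?_, ?_, ?_, ?_⟩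
    · rw [hop 0]; exact hr 0
    · rw [hop 1]; exact hr 1
    · rw [hop 2]; exact hr 2
    · rw [hop 3]; exact hr 3
    · rw [hn, Fin.sum_univ_four]; rfl
    · rw [hn, ← ofReal_paramNorm]; exact ENNReal.ofReal_lt_top
  · exact Finset.single_le_sum
      (f := fun i => rangeNorm p₁ p₂ i (analysisOp α₁ α₂ p₁ φ₁ p₂ φ₂ i f))
      (fun _ _ => zero_le) (Finset.mem_univ i)
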